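/- Let $n\ge 2$. Let $H^2(\mathbb D^n)$ be the Hardy space of the polydisc, i.e. the Hilbert space of power series $f(z)=\sum_{k\in\mathbb N^n}a_kz^k$ on $\mathbb D^n$ with $\|f\|^2=\sum_k|a_k|^2<\infty$. Let $M_{z_1},\dots,M_{z_n}$ be the operators of multiplication by the coordinate functions, and let $\mathcal T(H^2(\mathbb D^n))$ be the $C^*$-algebra they generate in $\mathcal B(H^2(\mathbb D^n))$. For a closed subspace $\mathcal S\subseteq H^2(\mathbb D^n)$ invariant under all $M_{z_i}$, let $\mathcal T(\mathcal S)\subseteq\mathcal B(\mathcal S)$ be the $C^*$-algebra generated by $R_{z_i}=P_{\mathcal S}M_{z_i}|_{\mathcal S}$, $i=1,\dots,n$, where $P_{\mathcal M}$ denotes the orthogonal projection onto a closed subspace $\mathcal M$. Let $\varphi_1,\dots,\varphi_n$ be finite Blaschke products, i.e. $\varphi_i(z)=c_i\prod_{j=1}^{N_i}\frac{z-a_{ij}}{1-\overline{a_{ij}}z}$ with $|c_i|=1$, $N_i\ge 0$ and $a_{ij}\in\mathbb D$. Put $\mathcal Q_{\varphi_i}=H^2(\mathbb D)\ominus\varphi_iH^2(\mathbb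 D)$ and, identifying $H^2(\mathbb D)\otimes\cdots\otimes H^2(\mathbb D)$ with $H^2(\mathbb D^n)$, put $$\mathcal S_\Phi=(\mathcal Q_{\varphi_1}\otimes\cdots\otimes\mathcal Q_{\varphi_n})^\perp\subseteq H^2(\mathbb D^n),$$ $$\mathcal L_1=(\mathcal Q_{\varphi_1}\otimes\cdots\otimes\mathcal Q_{\varphi_{n-1}})^\perp\otimes H^2(\mathbb D),\qquad \mathcal L_3=(\mathcal Q_{\varphi_1}\otimes\cdots\otimes\mathcal Q_{\varphi_{n-1}})\otimes H^2(\mathbb D),$$ where the orthogonal complement in $\mathcal L_1$ is taken in $H^2(\mathbb D^{n-1})$. Let $(M_{\varphi_n}f)(z)=\varphi_n(z_n)f(z)$ for $f\in H^2(\mathbb D^n)$. Then $U=P_{\mathcal L_1}+M_{\varphi_n}P_{\mathcal L_3}$ is a unitary operator from $H^2(\mathbb D^n)$ onto $\mathcal S_\Phi$, and $$U^*\,\mathcal T(\mathcal S_\Phi)\,U=\mathcal T(H^2(\mathbb D^n)).$$ In particular, $\mathcal T(\mathcal S_\Phi)$ and $\mathcal T(H^2(\mathbb D^n))$ are unitarily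 equivalent. -/

import Mathlib

open scoped ENNReal InnerProductSpace Complex.UnitDisc ComplexConjugate

noncomputable section

namespace PolydiscHardy

/-! ### The Hardy space of the polydisc -/

/-- The Hardy space `H²(𝔻ⁿ)`, the Hilbert space of all power series `∑ a_k z^k` (`k ∈ ℕⁿ`) with
`∑ |a_k|² < ∞`. An element is stored through its family of Taylor coefficients; the
holomorphic function on `𝔻ⁿ` which it represents is `eval f` below, and `eval_injective` shows
that this function determines the element. -/
abbrev H2 (n : ℕ) : Type := lp (fun _ : Fin n → ℕ => ℂ) 2

/-- The value at a point `z` of the polydisc of the function `f ∈ H²(𝔻ⁿ)`. -/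
def eval {n : ℕ} (f : H2 n) (z : Fin n → 𝔻) : ℂ :=
  ∑' k : Fin n → ℕ, f k * ∏ i, (z i : ℂ) ^ k i

theorem summable_prod_family {n : ℕ} (g : Fin n → ℕ → ℝ) (h0 : ∀ i j, 0 ≤ g i j)
    (hg : ∀ i, Summable (g i)) : Summable fun k : Fin n → ℕ => ∏ i, g i (k i) := by
  classical
  refine summable_of_sum_le (c := ∏ i, ∑' j, g i j)
    (fun k => Finset.prod_nonneg fun i _ => h0 _ _) fun s => ?_
  calc ∑ k ∈ s, ∏ i, g i (k i)
      ≤ ∑ k ∈ Fintype.piFinset (fun i => s.image fun k => k i), ∏ i, g i (k i) := by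
        refine Finset.sum_le_sum_of_subset_of_nonneg (fun k hk => ?_)
          fun k _ _ => Finset.prod_nonneg fun i _ => h0 _ _
        rw [Fintype.mem_piFinset]
        exact fun i => Finset.mem_image_of_mem _ hk
    _ = ∏ i, ∑ j ∈ s.image (fun k => k i), g i j := by
        rw [Finset.prod_univ_sum]
    _ ≤ ∏ i, ∑' j, g i j :=
        Finset.prod_le_prod (fun i _ => Finset.sum_nonneg fun j _ => h0 _ _)
          fun i _ => (hg i).sum_le_tsum _ fun j _ => h0 _ _

/-- The Szegő kernel function at the point `z`. -/
def szego {n : ℕ} (z : Fin n → 𝔻) : H2 n :=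
  ⟨fun k => ∏ i, conj (z i : ℂ) ^ k i, by
    refine memℓp_gen ?_
    have := summable_prod_family (fun i j => (‖(z i : ℂ)‖ ^ 2) ^ j)
      (fun i j => by positivity)
      (fun i => summable_geometric_of_lt_one (by positivity) (z i).sq_norm_lt_one)
    refine this.congr fun k => ?_
    simp only [norm_prod, norm_pow, RCLike.norm_conj, ENNReal.toReal_ofNat, Real.rpow_ofNat]
    simp only [← pow_mul, mul_comm 2]
    rw [← Finset.prod_pow]
    simp only [← pow_mul]⟩

theorem eval_eq_inner {n : ℕ} (f : H2 n) (z : Fin n → 𝔻) : eval f z = ⟪szego z, f⟫_ℂ := by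
  rw [lp.inner_eq_tsum]
  refine tsum_congr fun k => ?_
  simp [szego]

theorem summable_eval {n : ℕ} (f : H2 n) (z : Fin n → 𝔻) :
    Summable fun k : Fin n → ℕ => f k * ∏ i, (z i : ℂ) ^ k i := by
  refine (lp.summable_inner (𝕜 := ℂ) (szego z) f).congr fun k => ?_
  simp [szego]

theorem eval_add {n : ℕ} (f g : H2 n) (z : Fin n → 𝔻) :
    eval (f + g) z = eval f z + eval g z := by
  simp only [eval_eq_inner, inner_add_right]

theorem eval_sub {n : ℕ} (f g : H2 n) (z : Fin n → 𝔻) :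
    eval (f - g) z = eval f z - eval g z := by
  simp only [eval_eq_inner, inner_sub_right]

theorem eval_smul {n : ℕ} (c : ℂ) (f : H2 n) (z : Fin n → 𝔻) :
    eval (c • f) z = c * eval f z := by
  simp only [eval_eq_inner, inner_smul_right]

theorem continuous_eval {n : ℕ} (z : Fin n → 𝔻) : Continuous fun f : H2 n => eval f z := by
  simp only [eval_eq_inner]
  fun_prop

/-- The coefficient family in the last `n` variables, for a fixed exponent `j` of the first. -/
def slice {n : ℕ} (f : H2 (n + 1)) (j : ℕ) : H2 n :=
  ⟨fun k => f (Fin.cons j k), by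
    have h := (lp.memℓp f).summable (by norm_num)
    refine memℓp_gen (h.comp_injective (i := fun k : Fin n → ℕ => (Fin.cons j k : Fin (n + 1) → ℕ))
      (Fin.cons_right_injective (α := fun _ => ℕ) j))⟩

theorem hasSum_slice {n : ℕ} (f : H2 (n + 1)) (w : 𝔻) (z : Fin n → 𝔻) :
    HasSum (fun j : ℕ => (w : ℂ) ^ j * eval (slice f j) z) (eval f (Fin.cons w z)) := by
  have h1 := (summable_eval f (Fin.cons w z)).hasSum
  rw [← (Fin.consEquiv (fun _ : Fin (n + 1) => ℕ)).hasSum_iff] at h1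
  refine HasSum.prod_fiberwise h1 fun j => ?_
  refine ((summable_eval (slice f j) z).hasSum.mul_left ((w : ℂ) ^ j)).congr fun k => ?_
  simp only [slice, Function.comp, Fin.consEquiv, Equiv.coe_fn_mk, Fin.prod_univ_succ, Fin.cons_zero,
    Fin.cons_succ]
  ring_nf

theorem eq_zero_of_eval {n : ℕ} : ∀ f : H2 n, (∀ z, eval f z = 0) → f = 0 := by
  induction n with
  | zero =>
    intro f hf
    have h := hf Fin.elim0
    ext k
    rw [eval, tsum_eq_single k fun k' hk' => absurd (Subsingleton.elim k' k) hk'] at h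
    simpa using h
  | succ n ih =>
    intro f hf
    have key : ∀ (z : Fin n → 𝔻) (j : ℕ), eval (slice f j) z = 0 := by
      intro z
      let p : FormalMultilinearSeries ℂ ℂ ℂ := fun j =>
        ContinuousMultilinearMap.mkPiRing ℂ (Fin j) (eval (slice f j) z)
      have hp : HasFPowerSeriesAt (0 : ℂ → ℂ) p 0 := by
        rw [hasFPowerSeriesAt_iff]
        filter_upwards [Metric.ball_mem_nhds (0 : ℂ) one_pos] with w hw
        have h := hasSum_slice f (Complex.UnitDisc.mk w (by simpa using hw)) z
        rw [hf] at h
        simpa [p, FormalMultilinearSeries.coeff] using h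
      intro j
      have h := hp.apply_eq_zero j 1
      simpa [p] using h
    ext k
    have h := ih (slice f (k 0)) (fun z => key z (k 0))
    have h' := congrArg (fun g : H2 n => g (Fin.tail k)) h
    simpa [slice] using h'

theorem eval_injective {n : ℕ} {f g : H2 n} (h : ∀ z, eval f z = eval g z) : f = g :=
  sub_eq_zero.1 (eq_zero_of_eval _ fun z => by rw [eval_sub, h z, sub_self])

/-! ### Multiplication operators -/

/-- The function `g` on the polydisc multiplies `H²(𝔻ⁿ)` into itself. -/
def IsMultiplier {n : ℕ} (g : (Fin n → 𝔻) → ℂ) : Prop :=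
  ∀ f : H2 n, ∃ h : H2 n, ∀ z, eval h z = g z * eval f z

/-- The bounded operator `M_g` of multiplication by `g`, `(M_g f)(z) = g(z) f(z)`. -/
def mulOp {n : ℕ} (g : (Fin n → 𝔻) → ℂ) (hg : IsMultiplier g) : H2 n →L[ℂ] H2 n where
  toFun f := (hg f).choose
  map_add' f₁ f₂ := eval_injective fun z => by
    rw [eval_add, (hg _).choose_spec, (hg _).choose_spec, (hg _).choose_spec, eval_add, mul_add]
  map_smul' c f := eval_injective fun z => by
    rw [RingHom.id_apply, eval_smul, (hg _).choose_spec, (hg _).choose_spec, eval_smul,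
      mul_left_comm]
  cont := by
    let T : H2 n →ₗ[ℂ] H2 n :=
      { toFun := fun f => (hg f).choose
        map_add' := fun f₁ f₂ => eval_injective fun z => by
          rw [eval_add, (hg _).choose_spec, (hg _).choose_spec, (hg _).choose_spec, eval_add,
            mul_add]
        map_smul' := fun c f => eval_injective fun z => by
          rw [RingHom.id_apply, eval_smul, (hg _).choose_spec, (hg _).choose_spec, eval_smul,
            mul_left_comm] }
    have hT : ∀ f z, eval (T f) z = g z * eval f z := fun f => (hg f).choose_spec
    refine T.continuous_of_seq_closed_graph fun u x y hu hy => eval_injective fun z => ?_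
    have h1 := ((continuous_eval z).tendsto y).comp hy
    have h2 := (((continuous_eval z).tendsto x).comp hu).const_mul (g z)
    rw [hT]
    refine tendsto_nhds_unique h1 (h2.congr fun m => ?_)
    simp [hT]

theorem eval_mulOp {n : ℕ} (g : (Fin n → 𝔻) → ℂ) (hg : IsMultiplier g) (f : H2 n)
    (z : Fin n → 𝔻) : eval (mulOp g hg f) z = g z * eval f z :=
  (hg f).choose_spec z

theorem isMultiplier_const {n : ℕ} (c : ℂ) : IsMultiplier fun _ : Fin n → 𝔻 => c :=
  fun f => ⟨c • f, fun z => eval_smul c f z⟩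

theorem IsMultiplier.mul {n : ℕ} {g₁ g₂ : (Fin n → 𝔻) → ℂ} (h₁ : IsMultiplier g₁)
    (h₂ : IsMultiplier g₂) : IsMultiplier fun z => g₁ z * g₂ z := fun f => by
  obtain ⟨u, hu⟩ := h₂ f
  obtain ⟨v, hv⟩ := h₁ u
  exact ⟨v, fun z => by rw [hv, hu, mul_assoc]⟩

/-- The coefficients of `z_i f`. -/
theorem exists_shift {n : ℕ} (i : Fin n) (f : H2 n) :
    ∃ h : H2 n, (∀ z, eval h z = (z i : ℂ) * eval f z) ∧ ‖h‖ = ‖f‖ := by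
  classical
  set s : (Fin n → ℕ) → (Fin n → ℕ) := fun k => k + Pi.single i 1 with hs
  have hinj : Function.Injective s := fun a b hab => add_right_cancel hab
  set c : (Fin n → ℕ) → ℂ := Function.extend s f 0 with hc
  have hcs : ∀ k, c (s k) = f k := fun k => hinj.extend_apply _ _ _
  have hc0 : ∀ k, k ∉ Set.range s → c k = 0 := fun k hk =>
    Function.extend_apply' _ _ _ (by simpa using hk)
  have hmem : Memℓp c 2 := by
    refine memℓp_gen ((hinj.summable_iff fun k hk => ?_).1 ?_)
    · simp [hc0 k hk]
    · refine ((lp.memℓp f).summable (by norm_num)).congr fun k => ?_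
      simp [hcs]
  refine ⟨⟨c, hmem⟩, fun z => ?_, ?_⟩
  · rw [eval, eval, ← tsum_mul_left, ← hinj.tsum_eq]
    · refine tsum_congr fun k => ?_
      have : ∏ x, (z x : ℂ) ^ (s k x) = (z i : ℂ) * ∏ x, (z x : ℂ) ^ k x := by
        simp only [hs, Pi.add_apply, pow_add, Finset.prod_mul_distrib]
        rw [mul_comm]
        congr 1
        rw [Finset.prod_eq_single i] <;> simp +contextual
      show c (s k) * _ = _
      rw [hcs, this]
      ring
    · intro k hk
      by_contra hk'
      exact hk (by simp [hc0 k hk'])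
  · have h2 : (0 : ℝ) < (2 : ℝ≥0∞).toReal := by norm_num
    rw [lp.norm_eq_tsum_rpow h2, lp.norm_eq_tsum_rpow h2]
    congr 1
    rw [← hinj.tsum_eq]
    · refine tsum_congr fun k => ?_
      show ‖c (s k)‖ ^ _ = _
      rw [hcs]
    · intro k hk
      by_contra hk'
      exact hk (by simp [hc0 k hk'])

theorem isMultiplier_coord {n : ℕ} (i : Fin n) :
    IsMultiplier fun z : Fin n → 𝔻 => (z i : ℂ) := fun f => by
  obtain ⟨h, hh, -⟩ := exists_shift i f
  exact ⟨h, hh⟩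

/-- The coordinate multiplication operator `M_{z_i}` on `H²(𝔻ⁿ)`. -/
def Mz {n : ℕ} (i : Fin n) : H2 n →L[ℂ] H2 n :=
  mulOp (fun z => (z i : ℂ)) (isMultiplier_coord i)

theorem norm_Mz_le {n : ℕ} (i : Fin n) : ‖Mz i‖ ≤ 1 := by
  refine ContinuousLinearMap.opNorm_le_bound _ zero_le_one fun f => ?_
  obtain ⟨h, hh, hn⟩ := exists_shift i f
  have : Mz i f = h := eval_injective fun z => by rw [Mz, eval_mulOp, hh]
  rw [this, hn, one_mul]

theorem isMultiplier_moebius {n : ℕ} (i : Fin n) (a : 𝔻) :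
    IsMultiplier fun z : Fin n → 𝔻 => ((z i : ℂ) - a) / (1 - conj (a : ℂ) * z i) := by
  intro f
  have hlt : ‖conj (a : ℂ) • Mz i‖ < 1 := by
    rw [norm_smul, RCLike.norm_conj]
    calc ‖(a : ℂ)‖ * ‖Mz i‖ ≤ ‖(a : ℂ)‖ * 1 := by gcongr; exact norm_Mz_le i
      _ < 1 := by rw [mul_one]; exact a.norm_lt_one
  have hU := isUnit_one_sub_of_norm_lt_one hlt
  obtain ⟨u, hu⟩ := hU
  set g : H2 n := (↑u⁻¹ : H2 n →L[ℂ] H2 n) f with hg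
  have h1 : g - conj (a : ℂ) • Mz i g = f := by
    have : ((u : H2 n →L[ℂ] H2 n) * ↑u⁻¹) f = f := by rw [Units.mul_inv]; rfl
    rw [hu] at this
    simpa using this
  refine ⟨Mz i g - (a : ℂ) • g, fun z => ?_⟩
  have hne : (1 : ℂ) - conj (a : ℂ) * z i ≠ 0 := by
    intro h0
    have : ‖conj (a : ℂ) * z i‖ < 1 := by
      rw [norm_mul, RCLike.norm_conj]
      exact mul_lt_one_of_nonneg_of_lt_one_left (norm_nonneg _) a.norm_lt_one (z i).norm_lt_one.le
    rw [← sub_eq_zero.1 h0] at this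
    simp at this
  rw [← h1]
  simp only [eval_sub, eval_smul, Mz, eval_mulOp]
  rw [div_mul_eq_mul_div, eq_div_iff hne]
  ring

/-! ### Finite Blaschke products -/

/-- `φ` is a finite Blaschke product, `φ(z) = c ∏_j (z - a_j) / (1 - \bar a_j z)` with `|c| = 1`
and finitely many `a_j ∈ 𝔻`, repetitions allowed. -/
def IsFiniteBlaschke (φ : 𝔻 → ℂ) : Prop :=
  ∃ (c : ℂ) (N : ℕ) (a : Fin N → 𝔻), ‖c‖ = 1 ∧
    ∀ z : 𝔻, φ z = c * ∏ j, ((z : ℂ) - a j) / (1 - conj (a j : ℂ) * z)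

theorem IsFiniteBlaschke.isMultiplier {φ : 𝔻 → ℂ} (hφ : IsFiniteBlaschke φ) {n : ℕ} (i : Fin n) :
    IsMultiplier fun z : Fin n → 𝔻 => φ (z i) := by
  classical
  obtain ⟨c, N, a, -, h⟩ := hφ
  simp only [h]
  refine (isMultiplier_const c).mul ?_
  induction (Finset.univ : Finset (Fin N)) using Finset.induction_on with
  | empty => simpa using isMultiplier_const (n := n) 1
  | insert j s hj ih =>
    simp only [Finset.prod_insert hj]
    exact (isMultiplier_moebius i (a j)).mul ih

/-! ### The subspaces -/

/-- `S_φ = φ H²(𝔻) ⊆ H²(𝔻)`. -/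
def Sone (φ : 𝔻 → ℂ) : Submodule ℂ (H2 1) where
  carrier := {h | ∃ f : H2 1, ∀ z, eval h z = φ (z 0) * eval f z}
  add_mem' := by
    rintro _ _ ⟨f, hf⟩ ⟨g, hg⟩
    exact ⟨f + g, fun z => by rw [eval_add, hf, hg, eval_add, mul_add]⟩
  zero_mem' := ⟨0, fun z => by simp [eval]⟩
  smul_mem' := by
    rintro c _ ⟨f, hf⟩
    exact ⟨c • f, fun z => by rw [eval_smul, hf, eval_smul, mul_left_comm]⟩

/-- `Q_φ = H²(𝔻) ⊖ φ H²(𝔻)`. -/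
def Qone (φ : 𝔻 → ℂ) : Submodule ℂ (H2 1) := (Sone φ)ᗮ

/-- The Hilbert space tensor product `E_1 ⊗ ⋯ ⊗ E_n` of subspaces of `H²(𝔻)`, inside
`H²(𝔻) ⊗ ⋯ ⊗ H²(𝔻) = H²(𝔻ⁿ)`: the closed linear span of the functions
`f_1(z_1) ⋯ f_n(z_n)` with `f_i ∈ E_i`. -/
def tensorPi {n : ℕ} (E : Fin n → Submodule ℂ (H2 1)) : Submodule ℂ (H2 n) :=
  (Submodule.span ℂ {F : H2 n | ∃ f : Fin n → H2 1, (∀ i, f i ∈ E i) ∧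
    ∀ z, eval F z = ∏ i, eval (f i) (fun _ => z i)}).topologicalClosure

/-- The Hilbert space tensor product `A ⊗ B` of `A ⊆ H²(𝔻ᵐ)` and `B ⊆ H²(𝔻)`, inside
`H²(𝔻ᵐ) ⊗ H²(𝔻) = H²(𝔻ᵐ⁺¹)`: the closed linear span of the functions
`f(z_1, …, z_m) g(z_{m+1})` with `f ∈ A`, `g ∈ B`. -/
def tensorLast {m : ℕ} (A : Submodule ℂ (H2 m)) (B : Submodule ℂ (H2 1)) :
    Submodule ℂ (H2 (m + 1)) :=
  (Submodule.span ℂ {F : H2 (m + 1) | ∃ f ∈ A, ∃ g ∈ B,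
    ∀ z, eval F z = eval f (Fin.init z) * eval g (fun _ => z (Fin.last m))}).topologicalClosure

instance {m : ℕ} (A : Submodule ℂ (H2 m)) (B : Submodule ℂ (H2 1)) :
    CompleteSpace (tensorLast A B) :=
  (Submodule.isClosed_topologicalClosure _).completeSpace_coe

/-- `S_Φ = (Q_{φ_1} ⊗ ⋯ ⊗ Q_{φ_n})^⊥ ⊆ H²(𝔻ⁿ)`. -/
def SPhi {n : ℕ} (φ : Fin n → 𝔻 → ℂ) : Submodule ℂ (H2 n) := (tensorPi fun i => Qone (φ i))ᗮ

instance {n : ℕ} (φ : Fin n → 𝔻 → ℂ) : CompleteSpace (SPhi φ) :=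
  inferInstanceAs (CompleteSpace ↥(tensorPi fun i => Qone (φ i))ᗮ)

/-- `L_1 = (Q_{φ_1} ⊗ ⋯ ⊗ Q_{φ_{n-1}})^⊥ ⊗ H²(𝔻)`, for `n = m + 1` functions. -/
def L1 {m : ℕ} (φ : Fin (m + 1) → 𝔻 → ℂ) : Submodule ℂ (H2 (m + 1)) :=
  tensorLast (tensorPi fun i : Fin m => Qone (φ i.castSucc))ᗮ ⊤

/-- `L_3 = (Q_{φ_1} ⊗ ⋯ ⊗ Q_{φ_{n-1}}) ⊗ H²(𝔻)`, for `n = m + 1` functions. -/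
def L3 {m : ℕ} (φ : Fin (m + 1) → 𝔻 → ℂ) : Submodule ℂ (H2 (m + 1)) :=
  tensorLast (tensorPi fun i : Fin m => Qone (φ i.castSucc)) ⊤

instance {m : ℕ} (φ : Fin (m + 1) → 𝔻 → ℂ) : CompleteSpace (L1 φ) :=
  inferInstanceAs (CompleteSpace (tensorLast _ _))

instance {m : ℕ} (φ : Fin (m + 1) → 𝔻 → ℂ) : CompleteSpace (L3 φ) :=
  inferInstanceAs (CompleteSpace (tensorLast _ _))

/-- The operator `P_{L_1} + M_{φ_n} P_{L_3}` on `H²(𝔻ⁿ)`, `n = m + 1`, where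
`(M_{φ_n} f)(z) = φ_n(z_n) f(z)`. -/
def UPhi {m : ℕ} (φ : Fin (m + 1) → 𝔻 → ℂ) (hφ : ∀ i, IsFiniteBlaschke (φ i)) :
    H2 (m + 1) →L[ℂ] H2 (m + 1) :=
  (L1 φ).starProjection +
    mulOp (fun z => φ (Fin.last m) (z (Fin.last m))) ((hφ (Fin.last m)).isMultiplier (Fin.last m)) ∘L
      (L3 φ).starProjection

/-! ### The C*-algebras -/

/-- The C*-algebra generated by a family of bounded operators (and the identity, which belongs to
it anyway if the family contains an isometry). -/
def cstarGen {ι H : Type*} [NormedAddCommGroup H] [InnerProductSpace ℂ H] [CompleteSpace H]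
    (A : ι → H →L[ℂ] H) : StarSubalgebra ℂ (H →L[ℂ] H) :=
  (StarAlgebra.adjoin ℂ (Set.range A)).topologicalClosure

/-- `R_{z_i} = P_S M_{z_i}|_S`. -/
def Rz {n : ℕ} (S : Submodule ℂ (H2 n)) [CompleteSpace S] (i : Fin n) : S →L[ℂ] S :=
  S.orthogonalProjectionOnto ∘L Mz i ∘L S.subtypeL

/-- `T(S)`, the C*-algebra generated by `R_{z_1}, …, R_{z_n}` on the closed subspace `S`. -/
def toeplitz {n : ℕ} (S : Submodule ℂ (H2 n)) [CompleteSpace S] :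
    StarSubalgebra ℂ (S →L[ℂ] S) :=
  cstarGen (Rz S)

/-- `T(H²(𝔻ⁿ))`, the C*-algebra generated by `M_{z_1}, …, M_{z_n}`. -/
def toeplitzFull (n : ℕ) : StarSubalgebra ℂ (H2 n →L[ℂ] H2 n) :=
  cstarGen (Mz (n := n))

end PolydiscHardy

end

open scoped ENNReal InnerProductSpace Complex.UnitDisc ComplexConjugate

noncomputable section

/-! Write `ζ = M_{z_n}`, `V = M_{φ_n}`, let `s` consist of the other coordinate operators, and let
`P` be the projection onto `L_3`. In each variable the projection onto `Q_φ` is `1 - M_φ M_φ*`, so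
`P` is a product of such defects and lies in C*(`s`), which commutes with C*(`ζ`). Hence `P_{L_1} =
1 - P` and `u = 1 - P + V P` is an isometry with defect `F = 1 - u u* = P (1 - V V*)`, the
projection onto `Q_{φ_1} ⊗ ⋯ ⊗ Q_{φ_n}`. So `u` maps onto `S_Φ`, and conjugating `R_{z_i}` gives `u*
M_{z_i} u`.

It remains to see that the algebra `A` generated by the `u* x u` equals the full Toeplitz algebra
`T` (`closedAdjoin_conj_eq`). As `u ∈ T`, `A ⊆ T`. Conversely, `u` commutes with `ζ`, so `ζ` and `V`
lie in `A`. For `x ∈ s`, `u* x u = a + b V + V* c`, where `a` is the diagonal part of `x` relative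
to `P` and `b`, `c` are its corners. Commutators with `V*` and `V` isolate `b (1 - V V*)` and `c (1
- V V*)`. For nonconstant `φ_n`, multiplication by elements of C*(`ζ`) turns `1 - V V*` into `e = 1
- ζ ζ*`, and so `x e ∈ A`. This spreads to `T e T ⊆ A`, and therefore to `T (1 - V V*) T ⊆ A`, which
is trivial for constant `φ_n`. Now `X ↦ u* X u` is multiplicative modulo `T F T ⊆ A`, so it maps `T`
into `A`; thus `P = u* P u` and `u` lie in `A`, and each generator is recovered from its compression
and terms containing `F`. -/

namespace PolydiscHardy

/-! ### Blaschke products of an isometry in a C⋆-algebra -/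

section Abstract

variable {E : Type*} [CStarAlgebra E]

/-- The Möbius transform `(ζ - a) (1 - \bar a ζ)⁻¹` of an element of a C⋆-algebra. -/
def moebius (ζ : E) (a : ℂ) : E := (ζ - a • 1) * Ring.inverse (1 - conj a • ζ)

/-- The finite Blaschke products of an element of a C⋆-algebra. -/
inductive IsBlaschkeOf (ζ : E) : E → Prop
  | const (c : ℂ) (hc : ‖c‖ = 1) : IsBlaschkeOf ζ (c • 1)
  | mul (a : ℂ) (ha : ‖a‖ < 1) (V : E) (hV : IsBlaschkeOf ζ V) : IsBlaschkeOf ζ (moebius ζ a * V)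

theorem exists_resolvent {ζ : E} (hn : ‖ζ‖ ≤ 1) {a : ℂ} (ha : ‖a‖ < 1) (A : StarSubalgebra ℂ E)
    (hA : IsClosed (A : Set E)) (hζ : ζ ∈ A) :
    ∃ g ∈ A, Ring.inverse (1 - conj a • ζ) = g ∧ g * (1 - conj a • ζ) = 1 ∧
      (1 - conj a • ζ) * g = 1 := by
  have hlt : ‖conj a • ζ‖ < 1 := by
    rw [norm_smul, RCLike.norm_conj]
    exact (mul_le_of_le_one_right (norm_nonneg _) hn).trans_lt ha
  have hU := isUnit_one_sub_of_norm_lt_one hlt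
  have hmem : 1 - conj a • ζ ∈ A := sub_mem (one_mem _) (A.smul_mem hζ _)
  -- Spectral permanence: an element of a closed star subalgebra that is invertible in `E` has its
  -- inverse in the subalgebra.
  have : CompleteSpace A := hA.completeSpace_coe
  have hU' : IsUnit (⟨_, hmem⟩ : A) := A.coe_isUnit.1 hU
  obtain ⟨w, hw⟩ := hU'
  have hw' : ((w : A) : E) = 1 - conj a • ζ := by rw [hw]
  have h1 : ((↑w⁻¹ : A) : E) * (1 - conj a • ζ) = 1 := by
    rw [← hw']; exact congrArg Subtype.val w.inv_mul
  refine ⟨((↑w⁻¹ : A) : E), (↑w⁻¹ : A).2, ?_, h1, ?_⟩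
  · have h2 := Ring.mul_inverse_cancel _ hU
    calc Ring.inverse (1 - conj a • ζ)
        = ((↑w⁻¹ : A) : E) * (1 - conj a • ζ) * Ring.inverse (1 - conj a • ζ) := by rw [h1, one_mul]
      _ = _ := by rw [mul_assoc, h2, mul_one]
  · rw [← hw', ← MulMemClass.coe_mul, w.mul_inv]
    simp

/-- Two identities carry this. `(ζ - a)*(ζ - a) = (1 - āζ)*(1 - āζ)` uses `ζ*ζ = 1` and makes the
transform an isometry; `(1 - āζ)(1 - āζ)* - (ζ - a)(ζ - a)* = (1 - |a|²)(1 - ζζ*)` gives its defect.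
-/
theorem exists_moebius_data {ζ : E} (hn : ‖ζ‖ ≤ 1) (h1 : star ζ * ζ = 1) {a : ℂ} (ha : ‖a‖ < 1)
    (A : StarSubalgebra ℂ E) (hA : IsClosed (A : Set E)) (hζ : ζ ∈ A) :
    ∃ g ∈ A, moebius ζ a ∈ A ∧ star (moebius ζ a) * moebius ζ a = 1 ∧
      g * (1 - conj a • ζ) = 1 ∧ (1 - conj a • ζ) * g = 1 ∧
      1 - moebius ζ a * star (moebius ζ a) =
        (1 - a * conj a) • (g * (1 - ζ * star ζ) * star g) := by
  obtain ⟨g, hgA, hg, hl, hr⟩ := exists_resolvent hn ha A hA hζ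
  have hm : moebius ζ a = (ζ - a • 1) * g := by rw [moebius, hg]
  have hcomm : (ζ - a • 1) * g = g * (ζ - a • 1) := by
    have hz : (1 - conj a • ζ) * (ζ - a • 1) = (ζ - a • 1) * (1 - conj a • ζ) := by
      simp only [mul_sub, sub_mul, mul_one, one_mul, smul_mul_assoc, mul_smul_comm]
      module
    calc (ζ - a • 1) * g = g * (1 - conj a • ζ) * (ζ - a • 1) * g := by rw [hl, one_mul]
      _ = g * (ζ - a • 1) * ((1 - conj a • ζ) * g) := by rw [mul_assoc g, hz]; simp only [mul_assoc]
      _ = g * (ζ - a • 1) := by rw [hr, mul_one]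
  have hls : (1 - a • star ζ) * star g = 1 := by
    have := congrArg star hl; simpa using this
  have hrs : star g * (1 - a • star ζ) = 1 := by
    have := congrArg star hr; simpa using this
  refine ⟨g, hgA, ?_, ?_, hl, hr, ?_⟩
  · rw [hm]
    exact mul_mem (sub_mem hζ (A.smul_mem (one_mem _) _)) hgA
  · have key : (star ζ - conj a • 1) * (ζ - a • 1) = (1 - a • star ζ) * (1 - conj a • ζ) := by
      simp only [mul_sub, sub_mul, mul_one, one_mul, smul_mul_assoc, mul_smul_comm, h1]
      module
    have hs : star (moebius ζ a) = star g * (star ζ - conj a • 1) := by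
      rw [hm]; simp
    rw [hs, hm, mul_assoc, ← mul_assoc (star ζ - conj a • 1), key, mul_assoc (1 - a • star ζ), hr,
      mul_one, hrs]
  · have hs : star (moebius ζ a) = (star ζ - conj a • 1) * star g := by
      rw [hm, hcomm]; simp
    have h3 : (1 : E) = g * ((1 - conj a • ζ) * (1 - a • star ζ)) * star g := by
      rw [← mul_assoc, hl, one_mul, hls]
    rw [hs, hm, hcomm]
    calc 1 - g * (ζ - a • 1) * ((star ζ - conj a • 1) * star g)
        = g * ((1 - conj a • ζ) * (1 - a • star ζ)) * star g -
          g * ((ζ - a • 1) * (star ζ - conj a • 1)) * star g := by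
          rw [← h3]; simp only [← mul_assoc]
      _ = g * ((1 - conj a • ζ) * (1 - a • star ζ) - (ζ - a • 1) * (star ζ - conj a • 1)) *
          star g := by rw [mul_sub g (_ * _), sub_mul _ _ (star g)]
      _ = _ := by
          rw [← smul_mul_assoc, ← mul_smul_comm]
          congr 2
          simp only [mul_sub, sub_mul, mul_one, one_mul, smul_mul_assoc, mul_smul_comm]
          module

theorem IsBlaschkeOf.mem {ζ V : E} (hV : IsBlaschkeOf ζ V) (hn : ‖ζ‖ ≤ 1) (h1 : star ζ * ζ = 1)
    (A : StarSubalgebra ℂ E) (hA : IsClosed (A : Set E)) (hζ : ζ ∈ A) : V ∈ A := by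
  induction hV with
  | const c hc => exact A.smul_mem (one_mem _) _
  | mul a ha V hV ih =>
    obtain ⟨-, -, hm, -⟩ := exists_moebius_data hn h1 ha A hA hζ
    exact mul_mem hm ih

theorem IsBlaschkeOf.commute {ζ V : E} (hV : IsBlaschkeOf ζ V) (hn : ‖ζ‖ ≤ 1) : Commute V ζ := by
  induction hV with
  | const c _ => exact (Commute.one_left _).smul_left c
  | mul a ha V _ ih =>
    refine Commute.mul_left (Commute.mul_left ?_ ?_) ih
    · exact (Commute.refl _).sub_left ((Commute.one_left _).smul_left _)
    · obtain ⟨g, -, hg, hl, hr⟩ := exists_resolvent hn ha ⊤ isClosed_univ trivial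
      rw [hg]
      have hc : ζ * (1 - conj a • ζ) = (1 - conj a • ζ) * ζ :=
        (Commute.one_right _).sub_right ((Commute.refl _).smul_right _)
      calc g * ζ = g * (ζ * (1 - conj a • ζ)) * g := by rw [mul_assoc, mul_assoc, hr, mul_one]
        _ = g * (1 - conj a • ζ) * ζ * g := by rw [hc]; simp only [mul_assoc]
        _ = ζ * g := by rw [hl, one_mul]

theorem IsBlaschkeOf.star_mul_self {ζ V : E} (hV : IsBlaschkeOf ζ V) (hn : ‖ζ‖ ≤ 1)
    (h1 : star ζ * ζ = 1) : star V * V = 1 := by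
  induction hV with
  | const c hc =>
    have : c * conj c = 1 := by rw [Complex.mul_conj', hc]; simp
    simp [smul_smul, this]
  | mul a ha V hV ih =>
    obtain ⟨-, -, -, hm, -⟩ := exists_moebius_data hn h1 ha ⊤ isClosed_univ trivial
    rw [star_mul, mul_assoc, ← mul_assoc (star (moebius ζ a)), hm, one_mul, ih]

/-- Defects telescope: `1 - bV(bV)* = (1 - bb*) + b(1 - VV*)b*`, and the defect of a single Möbius
factor is a two-sided multiple of `1 - ζζ*`. -/
theorem IsBlaschkeOf.defect_mem {ζ V : E} (hV : IsBlaschkeOf ζ V) (hn : ‖ζ‖ ≤ 1)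
    (h1 : star ζ * ζ = 1) (A : StarSubalgebra ℂ E) (hA : IsClosed (A : Set E)) (hζ : ζ ∈ A)
    (I : Submodule ℂ E) (hI : ∀ X ∈ A, ∀ Z ∈ I, ∀ Y ∈ A, X * Z * Y ∈ I)
    (he : 1 - ζ * star ζ ∈ I) : 1 - V * star V ∈ I := by
  induction hV with
  | const c hc =>
    have : conj c * c = 1 := by rw [Complex.conj_mul', hc]; simp
    simp [smul_smul, this]
  | mul a ha V hV ih =>
    obtain ⟨g, hg, hmA, -, -, -, hm⟩ := exists_moebius_data hn h1 ha A hA hζ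
    have h2 : 1 - moebius ζ a * V * star (moebius ζ a * V) =
        (1 - moebius ζ a * star (moebius ζ a)) +
          moebius ζ a * (1 - V * star V) * star (moebius ζ a) := by
      rw [star_mul]; noncomm_ring
    rw [h2, hm]
    exact add_mem (I.smul_mem _ (hI _ hg _ he _ (star_mem hg))) (hI _ hmA _ ih _ (star_mem hmA))

/-- The outermost Möbius factor `b` suffices: `(1 - bb*)b = 0`, so left multiplication by `1 - bb*`
reduces the defect of `bV` to that of `b`, and the resolvents around `1 - ζζ*` can then be
cancelled. -/
theorem IsBlaschkeOf.const_or {ζ V : E} (hV : IsBlaschkeOf ζ V) (hn : ‖ζ‖ ≤ 1)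
    (h1 : star ζ * ζ = 1) (A : StarSubalgebra ℂ E) (hA : IsClosed (A : Set E)) (hζ : ζ ∈ A) :
    1 - V * star V = 0 ∨ ∃ k ∈ A, ∃ l ∈ A, k * (1 - V * star V) * l = 1 - ζ * star ζ := by
  cases hV with
  | const c hc =>
    have : conj c * c = 1 := by rw [Complex.conj_mul', hc]; simp
    left; simp [smul_smul, this]
  | mul a ha V hV =>
    right
    obtain ⟨g, hg, hmA, hm1, hl, hr, hm⟩ := exists_moebius_data hn h1 ha A hA hζ
    set b := moebius ζ a
    have hne : 1 - a * conj a ≠ 0 := by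
      rw [Complex.mul_conj']
      have : ‖a‖ ^ 2 < 1 := by nlinarith [norm_nonneg a]
      intro h
      rw [sub_eq_zero] at h
      exact this.ne (by exact_mod_cast h.symm)
    have h2 : (1 - b * star b) * (1 - b * V * star (b * V)) = 1 - b * star b := by
      have : (1 - b * star b) * b = 0 := by
        rw [sub_mul, mul_assoc, hm1]; simp
      rw [mul_sub, mul_assoc b, ← mul_assoc _ b, this, zero_mul, sub_zero, mul_one]
    have hfa : 1 - conj a • ζ ∈ A := sub_mem (one_mem _) (A.smul_mem hζ _)
    have hls : star g * star (1 - conj a • ζ) = 1 := by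
      rw [← star_mul, hr, star_one]
    refine ⟨(1 - a * conj a)⁻¹ • ((1 - conj a • ζ) * (1 - b * star b)),
      A.smul_mem (mul_mem hfa (sub_mem (one_mem _) (mul_mem hmA (star_mem hmA)))) _,
      star (1 - conj a • ζ), star_mem hfa, ?_⟩
    rw [smul_mul_assoc, mul_assoc (1 - conj a • ζ), h2, hm, mul_smul_comm, smul_mul_assoc,
      smul_mul_assoc, smul_smul,
      inv_mul_cancel₀ hne, one_smul]
    calc (1 - conj a • ζ) * (g * (1 - ζ * star ζ) * star g) * star (1 - conj a • ζ)
        = ((1 - conj a • ζ) * g) * (1 - ζ * star ζ) * (star g * star (1 - conj a • ζ)) := by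
          simp only [mul_assoc]
      _ = _ := by rw [hr, hls, one_mul, mul_one]

/-! ### Passing from generators to the generated C⋆-algebra -/

/-- The C⋆-algebra generated by a set. -/
def closedAdjoin (s : Set E) : StarSubalgebra ℂ E := (StarAlgebra.adjoin ℂ s).topologicalClosure

theorem isClosed_closedAdjoin (s : Set E) : IsClosed (closedAdjoin s : Set E) :=
  StarSubalgebra.isClosed_topologicalClosure _

theorem subset_closedAdjoin (s : Set E) : s ⊆ closedAdjoin s :=
  (StarAlgebra.subset_adjoin ℂ s).trans (StarSubalgebra.le_topologicalClosure _)

theorem closedAdjoin_le {s : Set E} {B : StarSubalgebra ℂ E} (hB : IsClosed (B : Set E))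
    (h : s ⊆ B) : closedAdjoin s ≤ B :=
  StarSubalgebra.topologicalClosure_minimal (StarAlgebra.adjoin_le h) hB

theorem commute_of_mem_closedAdjoin {s : Set E} {y : E} (h : ∀ x ∈ s, Commute x y)
    (h' : ∀ x ∈ s, Commute x (star y)) {x : E} (hx : x ∈ closedAdjoin s) :
    Commute x y ∧ Commute x (star y) := by
  have hle : closedAdjoin s ≤ StarSubalgebra.centralizer ℂ {y} := by
    refine closedAdjoin_le (Set.isClosed_centralizer _) fun x hx => ?_
    rw [SetLike.mem_coe, StarSubalgebra.mem_centralizer_iff]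
    rintro _ rfl
    exact ⟨(h x hx).symm, (h' x hx).symm⟩
  have := (StarSubalgebra.mem_centralizer_iff ℂ).1 (hle hx) y rfl
  exact ⟨this.1.symm, this.2.symm⟩

/-- Since `e` is a projection, `XYe = (Xe)(Ye)` for `X`, `Y` commuting with `e`; the admissible `X`
therefore form a closed star subalgebra. -/
theorem mul_proj_mem_of_generators {s : Set E} {A : StarSubalgebra ℂ E} (hA : IsClosed (A : Set E))
    {e : E} (he : e ∈ A) (hsa : star e = e) (hi : e * e = e) (hc : ∀ x ∈ s, Commute x e)
    (hs : ∀ x ∈ s, x * e ∈ A) {X : E} (hX : X ∈ closedAdjoin s) : X * e ∈ A := by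
  let D : StarSubalgebra ℂ E :=
    { carrier := {X | X * e = e * X ∧ X * e ∈ A}
      mul_mem' := by
        rintro X Y ⟨hX, hX'⟩ ⟨hY, hY'⟩
        refine ⟨by rw [mul_assoc, hY, ← mul_assoc, hX, mul_assoc], ?_⟩
        have : X * Y * e = (X * e) * (Y * e) := by
          calc X * Y * e = X * (Y * e * e) := by rw [mul_assoc Y, hi, mul_assoc]
            _ = _ := by rw [hY]; simp only [mul_assoc]; rw [hY]
        rw [this]
        exact mul_mem hX' hY'
      add_mem' := by
        rintro X Y ⟨hX, hX'⟩ ⟨hY, hY'⟩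
        exact ⟨by rw [add_mul, mul_add, hX, hY], by rw [add_mul]; exact add_mem hX' hY'⟩
      algebraMap_mem' := fun c => ⟨Algebra.commutes c e, by
        rw [Algebra.algebraMap_eq_smul_one, smul_mul_assoc, one_mul]
        exact A.smul_mem he c⟩
      star_mem' := by
        rintro X ⟨hX, hX'⟩
        have h1 : star X * e = star (e * X) := by rw [star_mul, hsa]
        have h2 : e * star X = star (X * e) := by rw [star_mul, hsa]
        exact ⟨by rw [h1, h2, hX], by rw [h1, ← hX]; exact star_mem hX'⟩ }
  have hD : IsClosed (D : Set E) :=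
    (isClosed_eq (by fun_prop) (by fun_prop)).inter (hA.preimage (f := fun X => X * e) (by fun_prop))
  exact (closedAdjoin_le hD (fun x hx => ⟨hc x hx, hs x hx⟩) hX).2

/-- In the application `e = 1 - ζζ*` need not commute with `ζ`, so the previous multiplicativity
argument does not extend to `ζ`. Instead, left multipliers are considered. -/
theorem mul_proj_mem_of_insert {s : Set E} {A : StarSubalgebra ℂ E} (hA : IsClosed (A : Set E))
    {e ζ : E} (hζ : ζ ∈ A) (hc : ∀ x ∈ s, Commute x ζ) (hc' : ∀ x ∈ s, Commute x (star ζ))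
    (hs : ∀ X ∈ closedAdjoin s, X * e ∈ A) {X : E} (hX : X ∈ closedAdjoin (insert ζ s)) :
    X * e ∈ A := by
  -- `I` contains `e` by `hs`. Left multiplication by `ζ` and `ζ*` preserves it because they move
  -- past every `Y`; left multiplication by `s` and its adjoints is absorbed into `Y`.
  set I : Set E := {Z | ∀ Y ∈ closedAdjoin s, Y * Z ∈ A} with hI
  have hIc : IsClosed I := by
    simp only [hI, Set.ofPred_forall]
    exact isClosed_iInter fun Y => isClosed_iInter fun _ =>
      hA.preimage (f := fun Z => Y * Z) (by fun_prop)
  let D : StarSubalgebra ℂ E :=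
    { carrier := {W | ∀ Z ∈ I, W * Z ∈ I ∧ star W * Z ∈ I}
      mul_mem' := by
        intro W W' h h' Z hZ
        refine ⟨?_, ?_⟩
        · rw [mul_assoc]; exact (h _ (h' _ hZ).1).1
        · rw [star_mul, mul_assoc]; exact (h' _ (h _ hZ).2).2
      add_mem' := by
        intro W W' h h' Z hZ
        refine ⟨fun Y hY => ?_, fun Y hY => ?_⟩
        · rw [add_mul, mul_add]; exact add_mem ((h Z hZ).1 Y hY) ((h' Z hZ).1 Y hY)
        · rw [star_add, add_mul, mul_add]; exact add_mem ((h Z hZ).2 Y hY) ((h' Z hZ).2 Y hY)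
      algebraMap_mem' := by
        intro c Z hZ
        refine ⟨fun Y hY => ?_, fun Y hY => ?_⟩
        · rw [Algebra.algebraMap_eq_smul_one, smul_mul_assoc, one_mul, mul_smul_comm]
          exact A.smul_mem (hZ Y hY) _
        · rw [Algebra.algebraMap_eq_smul_one, star_smul, star_one, smul_mul_assoc, one_mul,
            mul_smul_comm]
          exact A.smul_mem (hZ Y hY) _
      star_mem' := fun {W} h Z hZ => ⟨(h Z hZ).2, by rw [star_star]; exact (h Z hZ).1⟩ }
  have hD : IsClosed (D : Set E) := by
    change IsClosed {W | ∀ Z ∈ I, W * Z ∈ I ∧ star W * Z ∈ I}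
    simp only [Set.ofPred_forall]
    exact isClosed_iInter fun Z => isClosed_iInter fun _ =>
      (hIc.preimage (f := fun W => W * Z) (by fun_prop)).inter
        (hIc.preimage (f := fun W => star W * Z) (by fun_prop))
  have hgen : insert ζ s ⊆ (D : Set E) := by
    rintro x (rfl | hx) Z hZ
    · refine ⟨fun Y hY => ?_, fun Y hY => ?_⟩
      · rw [← mul_assoc, (commute_of_mem_closedAdjoin hc hc' hY).1.eq, mul_assoc]
        exact mul_mem hζ (hZ Y hY)
      · rw [← mul_assoc, (commute_of_mem_closedAdjoin hc hc' hY).2.eq, mul_assoc]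
        exact mul_mem (star_mem hζ) (hZ Y hY)
    · have hx' := subset_closedAdjoin s hx
      refine ⟨fun Y hY => ?_, fun Y hY => ?_⟩
      · rw [← mul_assoc]; exact hZ _ (mul_mem hY hx')
      · rw [← mul_assoc]; exact hZ _ (mul_mem hY (star_mem hx'))
  have := (closedAdjoin_le hD hgen hX e hs).1 1 (one_mem _)
  rwa [one_mul] at this

/-- Compression is multiplicative up to an error already in `A`: `u*XYu = (u*Xu)(u*Yu) + u*X F Yu`.
-/
theorem compression_mem {s : Set E} {A : StarSubalgebra ℂ E} (hA : IsClosed (A : Set E))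
    {u F : E} (hu : star u * u = 1) (hF : 1 - u * star u = F) (huT : u ∈ closedAdjoin s)
    (hFA : ∀ X ∈ closedAdjoin s, ∀ Y ∈ closedAdjoin s, X * F * Y ∈ A)
    (hs : ∀ x ∈ s, star u * x * u ∈ A) {X : E} (hX : X ∈ closedAdjoin s) :
    star u * X * u ∈ A := by
  let D : StarSubalgebra ℂ E :=
    { carrier := {X | X ∈ closedAdjoin s ∧ star u * X * u ∈ A}
      mul_mem' := by
        rintro X Y ⟨hX, hX'⟩ ⟨hY, hY'⟩
        refine ⟨mul_mem hX hY, ?_⟩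
        have : star u * (X * Y) * u = (star u * X * u) * (star u * Y * u) +
            (star u * X) * F * (Y * u) := by
          rw [← hF]; noncomm_ring
        rw [this]
        exact add_mem (mul_mem hX' hY') (hFA _ (mul_mem (star_mem huT) hX) _ (mul_mem hY huT))
      add_mem' := by
        rintro X Y ⟨hX, hX'⟩ ⟨hY, hY'⟩
        exact ⟨add_mem hX hY, by rw [mul_add, add_mul]; exact add_mem hX' hY'⟩
      algebraMap_mem' := fun c => ⟨algebraMap_mem _ c, by
        rw [← Algebra.commutes, mul_assoc, hu, mul_one]; exact algebraMap_mem _ c⟩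
      star_mem' := by
        rintro X ⟨hX, hX'⟩
        exact ⟨star_mem hX, by simpa [mul_assoc] using star_mem hX'⟩ }
  have hD : IsClosed (D : Set E) :=
    (isClosed_closedAdjoin s).inter (hA.preimage (f := fun X => star u * X * u) (by fun_prop))
  exact (closedAdjoin_le hD (fun x hx => ⟨subset_closedAdjoin s hx, hs x hx⟩) hX).2

/-! ### The isometry `1 - P + VP` and the algebra of its compressions -/

/-- The terms `a` and `V*c` commute with `V*`, so only `bV` contributes to the commutator. The next
lemma extracts `c` in the same way with `V`. -/
theorem star_mul_sub_mul_star {V B a b c : E} (hB : B = a + b * V + star V * c)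
    (ha : Commute a (star V)) (hb : Commute b (star V)) (hc : Commute c (star V))
    (h1 : star V * V = 1) : star V * B - B * star V = b * (1 - V * star V) := by
  have h2 : star V * b * V = b := by rw [← hb.eq, mul_assoc, h1, mul_one]
  have e1 : star V * B = star V * a + star V * b * V + star V * (star V * c) := by
    rw [hB]; noncomm_ring
  have e2 : B * star V = a * star V + b * (V * star V) + star V * (c * star V) := by
    rw [hB]; noncomm_ring
  rw [e1, e2, h2, ha.eq, hc.eq]
  noncomm_ring

theorem mul_sub_mul_defect {V B a b c : E} (hB : B = a + b * V + star V * c)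
    (ha : Commute a V) (hb : Commute b V) (hc : Commute c V) (hc' : Commute c (star V))
    (h1 : star V * V = 1) : B * V - V * B = c * (1 - V * star V) := by
  have h2 : star V * c * V = c := by rw [← hc'.eq, mul_assoc, h1, mul_one]
  have h3 : V * star V * c = c * (V * star V) := by
    rw [mul_assoc, ← hc'.eq, ← mul_assoc, ← hc.eq, mul_assoc]
  have e1 : B * V = a * V + b * V * V + star V * c * V := by
    rw [hB]; noncomm_ring
  have e2 : V * B = V * a + V * b * V + V * star V * c := by
    rw [hB]; noncomm_ring
  rw [e1, e2, h2, h3, ha.eq, hb.eq]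
  noncomm_ring

theorem isometry_of_corner {P V u : E} (hPs : star P = P) (hPi : P * P = P) (hPV : Commute P V)
    (hPV' : Commute P (star V)) (hVV : star V * V = 1) (hu : u = 1 - P + V * P) :
    star u * u = 1 ∧ 1 - u * star u = P * (1 - V * star V) := by
  have hsu : star u = 1 - P + P * star V := by rw [hu]; simp [hPs]
  have hPc : P * (1 - P) = 0 := by rw [mul_sub, mul_one, hPi, sub_self]
  have hPc' : (1 - P) * P = 0 := by rw [sub_mul, one_mul, hPi, sub_self]
  have hPcc : (1 - P) * (1 - P) = 1 - P := by rw [mul_sub, hPc', mul_one, sub_zero]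
  constructor
  · have e1 : star u * u = (1 - P) * (1 - P) + (1 - P) * (V * P) + P * star V * (1 - P) +
        P * (star V * V) * P := by rw [hsu, hu]; noncomm_ring
    have e2 : (1 - P) * (V * P) = 0 := by
      rw [← hPV.eq, ← mul_assoc, hPc', zero_mul]
    have e3 : P * star V * (1 - P) = 0 := by
      rw [hPV'.eq, mul_assoc, hPc, mul_zero]
    rw [e1, e2, e3, hVV, hPcc, mul_one, hPi]; abel
  · have e1 : u * star u = (1 - P) * (1 - P) + (1 - P) * P * star V + V * (P * (1 - P)) +
        V * (P * P) * star V := by rw [hsu, hu]; noncomm_ring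
    rw [e1, hPcc, hPc', hPc, hPi, ← hPV.eq]; noncomm_ring

theorem closedAdjoin_conj_eq {s : Set E} {ζ P V u : E} (hn : ‖ζ‖ ≤ 1) (h1 : star ζ * ζ = 1)
    (hc : ∀ x ∈ s, Commute x ζ) (hc' : ∀ x ∈ s, Commute x (star ζ))
    (hP : P ∈ closedAdjoin s) (hPs : star P = P) (hPi : P * P = P) (hV : IsBlaschkeOf ζ V)
    (hu : u = 1 - P + V * P) :
    closedAdjoin ((fun x => star u * x * u) '' insert ζ s) = closedAdjoin (insert ζ s) := by
  set T := closedAdjoin (insert ζ s) with hT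
  set A := closedAdjoin ((fun x => star u * x * u) '' insert ζ s) with hA
  have hTc : IsClosed (T : Set E) := isClosed_closedAdjoin _
  have hAc : IsClosed (A : Set E) := isClosed_closedAdjoin _
  have hVV := hV.star_mul_self hn h1
  have hζT : ζ ∈ T := subset_closedAdjoin _ (Set.mem_insert _ _)
  have hsT : closedAdjoin s ≤ T :=
    closedAdjoin_le hTc ((Set.subset_insert _ _).trans (subset_closedAdjoin _))
  have hVT : V ∈ T := hV.mem hn h1 T hTc hζT
  have huT : u ∈ T := by
    rw [hu]; exact add_mem (sub_mem (one_mem _) (hsT hP)) (mul_mem hVT (hsT hP))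
  set C := closedAdjoin ({ζ} : Set E) with hC
  have hCc : IsClosed (C : Set E) := isClosed_closedAdjoin _
  have hζC : ζ ∈ C := subset_closedAdjoin _ rfl
  have hVC : V ∈ C := hV.mem hn h1 C hCc hζC
  have hcommC : ∀ X ∈ closedAdjoin s, ∀ W ∈ C, Commute X W := by
    intro X hX W hW
    obtain ⟨h2, h3⟩ := commute_of_mem_closedAdjoin hc hc' hX
    refine ((commute_of_mem_closedAdjoin (s := {ζ}) ?_ ?_ hW).1).symm
    · rintro _ rfl; exact h2.symm
    · rintro _ rfl; simpa using h3.symm.star_star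
  have hcomm : ∀ X ∈ closedAdjoin s, Commute X V ∧ Commute X (star V) := fun X hX =>
    ⟨hcommC X hX V hVC, hcommC X hX _ (star_mem hVC)⟩
  obtain ⟨hPV, hPV'⟩ := hcomm P hP
  have hsu : star u = 1 - P + P * star V := by rw [hu]; simp [hPs]
  obtain ⟨hu1, hu2⟩ := isometry_of_corner hPs hPi hPV hPV' hVV hu
  -- Block decomposition relative to `P`: in the corner `P x P` the factors `V*` and `V` meet and
  -- cancel, while each off-diagonal corner keeps one of them.
  have hconj : ∀ x ∈ closedAdjoin s, star u * x * u =
      ((1 - P) * x * (1 - P) + P * x * P) + ((1 - P) * x * P) * V +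
        star V * (P * x * (1 - P)) := by
    intro x hx
    have e1 : star u * x * u = (1 - P) * x * (1 - P) + (1 - P) * x * (V * P) +
        P * star V * x * (1 - P) + P * star V * x * (V * P) := by rw [hsu, hu]; noncomm_ring
    have e2 : P * star V * x * (V * P) = P * x * P := by
      calc P * star V * x * (V * P) = P * (star V * x) * V * P := by simp only [mul_assoc]
        _ = P * x * (star V * V) * P := by rw [← (hcomm x hx).2.eq]; simp only [mul_assoc]
        _ = _ := by rw [hVV, mul_one]
    rw [e1, e2, ← hPV.eq, hPV'.eq]; noncomm_ring
  have hζconj : star u * ζ * u = ζ := by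
    obtain ⟨hPζ, -⟩ := commute_of_mem_closedAdjoin hc hc' hP
    have huζ : Commute u ζ := by
      rw [hu]
      refine ((Commute.one_left _).sub_left hPζ).add_left (Commute.mul_left ?_ hPζ)
      exact hV.commute hn
    rw [mul_assoc, ← huζ.eq, ← mul_assoc, hu1, one_mul]
  have hζA : ζ ∈ A := subset_closedAdjoin _ ⟨ζ, Set.mem_insert _ _, hζconj⟩
  have hVA : V ∈ A := hV.mem hn h1 A hAc hζA
  have hsA : ∀ x ∈ s, star u * x * u ∈ A := fun x hx =>
    subset_closedAdjoin _ ⟨x, Set.mem_insert_of_mem _ hx, rfl⟩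
  set e := 1 - ζ * star ζ with he
  have heA : e ∈ A := sub_mem (one_mem _) (mul_mem hζA (star_mem hζA))
  have hes : star e = e := by simp [he]
  have hei : e * e = e := by
    have : e * ζ = 0 := by rw [he, sub_mul, mul_assoc, h1]; simp
    nth_rewrite 2 [he]
    rw [mul_sub, ← mul_assoc, this]; simp
  have hCA : C ≤ A := closedAdjoin_le hAc (by rintro _ rfl; exact hζA)
  have hCT : C ≤ T := closedAdjoin_le hTc (by rintro _ rfl; exact hζT)
  have hdefect : ∀ X ∈ T, ∀ Y ∈ T, X * (1 - V * star V) * Y ∈ A := by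
    -- A constant `V` has zero defect; otherwise `k` and `l` convert the defect of `V` into `e`.
    rcases hV.const_or hn h1 C hCc hζC with h0 | ⟨k, hk, l, hl, hkl⟩
    · intro X _ Y _
      rw [h0]; simp
    have hxe : ∀ x ∈ s, x * e ∈ A := by
      intro x hx
      have hxs := subset_closedAdjoin s hx
      have hB := hconj x hxs
      have hPm : 1 - P ∈ closedAdjoin s := sub_mem (one_mem _) hP
      have haM := add_mem (mul_mem (mul_mem hPm hxs) hPm) (mul_mem (mul_mem hP hxs) hP)
      have hbM := mul_mem (mul_mem hPm hxs) hP
      have hcM := mul_mem (mul_mem hP hxs) hPm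
      have hxabc : x = ((1 - P) * x * (1 - P) + P * x * P) + (1 - P) * x * P +
          P * x * (1 - P) := by noncomm_ring
      set a := (1 - P) * x * (1 - P) + P * x * P
      set b := (1 - P) * x * P
      set c := P * x * (1 - P)
      -- As `k ∈ C` commutes with `y`, the factor `k` can be moved to the left of `y`, where it is a
      -- multiplication within `A`.
      have hk' : ∀ y ∈ closedAdjoin s, y * (1 - V * star V) ∈ A → y * e ∈ A := by
        intro y hy hyA
        have : y * e = k * (y * (1 - V * star V)) * l := by
          rw [he, ← hkl, ← mul_assoc k, ← (hcommC y hy k hk).eq]; simp only [mul_assoc]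
        rw [this]
        exact mul_mem (mul_mem (hCA hk) hyA) (hCA hl)
      have hbe : b * e ∈ A := hk' b hbM <| by
        rw [← star_mul_sub_mul_star hB (hcomm _ haM).2 (hcomm _ hbM).2 (hcomm _ hcM).2 hVV]
        exact sub_mem (mul_mem (star_mem hVA) (hsA x hx)) (mul_mem (hsA x hx) (star_mem hVA))
      have hce : c * e ∈ A := hk' c hcM <| by
        rw [← mul_sub_mul_defect hB (hcomm _ haM).1 (hcomm _ hbM).1 (hcomm _ hcM).1
          (hcomm _ hcM).2 hVV]
        exact sub_mem (mul_mem (hsA x hx) hVA) (mul_mem hVA (hsA x hx))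
      -- With the corners known after multiplication by `e`, the diagonal part is what remains of
      -- `u*xu e`.
      have hae : a * e = star u * x * u * e - V * (b * e) - star V * (c * e) := by
        rw [hB, (hcomm b hbM).1.eq]; noncomm_ring
      rw [hxabc, add_mul, add_mul, hae]
      exact add_mem (add_mem (sub_mem (sub_mem (mul_mem (hsA x hx) heA) (mul_mem hVA hbe))
        (mul_mem (star_mem hVA) hce)) hbe) hce
    have hxe' : ∀ x ∈ s, Commute x e := fun x hx =>
      hcommC x (subset_closedAdjoin s hx) e
        (sub_mem (one_mem _) (mul_mem hζC (star_mem hζC)))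
    have hTe : ∀ X ∈ T, X * e ∈ A := fun X hX =>
      mul_proj_mem_of_insert hAc hζA hc hc'
        (fun X hX => mul_proj_mem_of_generators hAc heA hes hei hxe' hxe hX) hX
    have hTeT : ∀ X ∈ T, ∀ Y ∈ T, X * e * Y ∈ A := by
      intro X hX Y hY
      have h2 : e * Y ∈ A := by
        have := star_mem (hTe _ (star_mem hY))
        rwa [star_mul, star_star, hes] at this
      have : X * e * Y = (X * e) * (e * Y) := by
        rw [← mul_assoc, mul_assoc X e e, hei]
      rw [this]
      exact mul_mem (hTe X hX) h2
    let I : Submodule ℂ E :=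
      { carrier := {Z | ∀ X ∈ T, ∀ Y ∈ T, X * Z * Y ∈ A}
        add_mem' := fun {Z W} hZ hW X hX Y hY => by
          rw [mul_add, add_mul]; exact add_mem (hZ X hX Y hY) (hW X hX Y hY)
        zero_mem' := fun X _ Y _ => by simp
        smul_mem' := fun c Z hZ X hX Y hY => by
          rw [mul_smul_comm, smul_mul_assoc]; exact A.smul_mem (hZ X hX Y hY) c }
    refine hV.defect_mem hn h1 C hCc hζC I ?_ hTeT
    intro X hX Z hZ Y hY X' hX' Y' hY'
    have : X' * (X * Z * Y) * Y' = (X' * X) * Z * (Y * Y') := by simp only [mul_assoc]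
    rw [this]
    exact hZ _ (mul_mem hX' (hCT hX)) _ (mul_mem (hCT hY) hY')
  have hF : ∀ X ∈ T, ∀ Y ∈ T, X * (P * (1 - V * star V)) * Y ∈ A := by
    intro X hX Y hY
    rw [← mul_assoc]
    exact hdefect _ (mul_mem hX (hsT hP)) _ hY
  refine le_antisymm (closedAdjoin_le hTc ?_) (closedAdjoin_le hAc ?_)
  · rintro _ ⟨x, hx, rfl⟩
    exact mul_mem (mul_mem (star_mem huT) (subset_closedAdjoin _ hx)) huT
  · have hPA : P ∈ A := by
      have h2 := compression_mem hAc hu1 hu2 huT hF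
        (fun x hx => subset_closedAdjoin _ ⟨x, hx, rfl⟩) (hsT hP)
      have h3 : Commute P u := by
        rw [hu]
        exact ((Commute.one_right _).sub_right (Commute.refl _)).add_right
          (hPV.mul_right (Commute.refl _))
      rwa [mul_assoc, h3.eq, ← mul_assoc, hu1, one_mul] at h2
    have huA : u ∈ A := by
      rw [hu]; exact add_mem (sub_mem (one_mem _) hPA) (mul_mem hVA hPA)
    intro x hx
    have hxT : x ∈ T := subset_closedAdjoin _ hx
    have hxA : star u * x * u ∈ A := subset_closedAdjoin _ ⟨x, hx, rfl⟩
    -- With `Q = uu*`, this is `x = QxQ + (1 - Q)x + Qx(1 - Q)`; the last two terms contain the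
    -- defect.
    have h2 : x = u * (star u * x * u) * star u + 1 * (1 - u * star u) * x +
        (u * star u * x) * (1 - u * star u) * 1 := by noncomm_ring
    rw [h2, hu2]
    exact add_mem (add_mem (mul_mem (mul_mem huA hxA) (star_mem huA)) (hF _ (one_mem _) _ hxT))
      (hF _ (mul_mem (mul_mem huT (star_mem huT)) hxT) _ (one_mem _))

end Abstract

/-! ### Functions with separated variables -/

/-- A multi-index in `m + 1` variables is a multi-index in `m` variables and one in the last. -/
def splitLast (m : ℕ) : (Fin (m + 1) → ℕ) ≃ (Fin m → ℕ) × (Fin 1 → ℕ) where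
  toFun k := (Fin.init k, fun _ => k (Fin.last m))
  invFun p := Fin.snoc (α := fun _ => ℕ) p.1 (p.2 0)
  left_inv k := by simp
  right_inv p := by
    ext i
    · simp
    · simp [Subsingleton.elim i 0]

/-- The function `f(z_1, …, z_m) g(z_{m+1})`. -/
def tens {m : ℕ} (f : H2 m) (g : H2 1) : H2 (m + 1) :=
  ⟨fun k => f (splitLast m k).1 * g (splitLast m k).2, by
    have hf : Summable fun k => ‖f k‖ ^ (2 : ℝ≥0∞).toReal :=
      (lp.memℓp f).summable (by norm_num)
    have hg : Summable fun k => ‖g k‖ ^ (2 : ℝ≥0∞).toReal :=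
      (lp.memℓp g).summable (by norm_num)
    have h := Summable.mul_of_nonneg hf hg (fun k => Real.rpow_nonneg (norm_nonneg (f k)) _)
      fun k => Real.rpow_nonneg (norm_nonneg (g k)) _
    refine memℓp_gen (((splitLast m).summable_iff.2 h).congr fun k => ?_)
    rw [norm_mul, Real.mul_rpow (norm_nonneg _) (norm_nonneg _)]
    rfl⟩

theorem inner_tens {m : ℕ} (f f' : H2 m) (g g' : H2 1) :
    ⟪tens f g, tens f' g'⟫_ℂ = ⟪f, f'⟫_ℂ * ⟪g, g'⟫_ℂ := by
  rw [lp.inner_eq_tsum, lp.inner_eq_tsum, lp.inner_eq_tsum,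
    tsum_mul_tsum_of_summable_norm
      (lp.summable_inner (𝕜 := ℂ) f f').norm (lp.summable_inner (𝕜 := ℂ) g g').norm,
    ← (splitLast m).tsum_eq]
  refine tsum_congr fun k => ?_
  simp only [tens, RCLike.inner_apply, map_mul]
  ring

theorem szego_eq_tens {m : ℕ} (z : Fin (m + 1) → 𝔻) :
    szego z = tens (szego (Fin.init z)) (szego fun _ => z (Fin.last m)) := by
  ext k
  simp [szego, tens, splitLast, Fin.prod_univ_castSucc, Fin.init]

/-- Evaluation is pairing with the Szegő kernel, which is itself a product over the variables. -/
theorem eval_tens {m : ℕ} (f : H2 m) (g : H2 1) (z : Fin (m + 1) → 𝔻) :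
    eval (tens f g) z = eval f (Fin.init z) * eval g (fun _ => z (Fin.last m)) := by
  simp only [eval_eq_inner, szego_eq_tens z, inner_tens]

/-- The function `f_1(z_1) ⋯ f_n(z_n)`. -/
def prodFun : {n : ℕ} → (Fin n → H2 1) → H2 n
  | 0, _ => szego Fin.elim0
  | _ + 1, f => tens (prodFun (Fin.init f)) (f (Fin.last _))

theorem szego_eq_prodFun {n : ℕ} (z : Fin n → 𝔻) :
    szego z = prodFun fun i => szego fun _ => z i := by
  induction n with
  | zero => rw [prodFun, Subsingleton.elim z Fin.elim0]
  | succ n ih => rw [szego_eq_tens, ih, prodFun]; rfl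

theorem inner_prodFun {n : ℕ} (f g : Fin n → H2 1) :
    ⟪prodFun f, prodFun g⟫_ℂ = ∏ i, ⟪f i, g i⟫_ℂ := by
  induction n with
  | zero =>
    rw [prodFun, prodFun, ← eval_eq_inner, eval,
      tsum_eq_single 0 fun k' hk' => absurd (Subsingleton.elim k' 0) hk']
    simp [szego]
  | succ n ih => rw [prodFun, prodFun, inner_tens, ih, Fin.prod_univ_castSucc]; rfl

theorem eval_prodFun {n : ℕ} (f : Fin n → H2 1) (z : Fin n → 𝔻) :
    eval (prodFun f) z = ∏ i, eval (f i) fun _ => z i := by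
  simp only [eval_eq_inner, szego_eq_prodFun z, inner_prodFun]

theorem span_szego_eq_top (n : ℕ) :
    (Submodule.span ℂ (Set.range (szego (n := n)))).topologicalClosure = ⊤ := by
  rw [Submodule.topologicalClosure_eq_top_iff, Submodule.eq_bot_iff]
  intro f hf
  refine eq_zero_of_eval f fun z => ?_
  rw [eval_eq_inner]
  exact hf _ (Submodule.subset_span ⟨z, rfl⟩)

/-- The kernels span a dense subspace, so closed linear conditions on an operator need only be
tested on them. -/
theorem mem_of_szego_mem {n : ℕ} {H : Type*} [NormedAddCommGroup H] [NormedSpace ℂ H]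
    (X : H2 n →L[ℂ] H) {K : Submodule ℂ H} (hK : IsClosed (K : Set H))
    (h : ∀ z, X (szego z) ∈ K) (f : H2 n) : X f ∈ K := by
  have hle : (Submodule.span ℂ (Set.range (szego (n := n)))).topologicalClosure ≤
      K.comap (X : H2 n →ₗ[ℂ] H) := by
    refine Submodule.topologicalClosure_minimal _ (Submodule.span_le.2 ?_)
      (hK.preimage X.continuous)
    rintro _ ⟨z, rfl⟩
    exact h z
  rw [span_szego_eq_top] at hle
  exact hle (Submodule.mem_top (x := f))

theorem ext_szego {n : ℕ} {H : Type*} [NormedAddCommGroup H] [NormedSpace ℂ H]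
    {X Y : H2 n →L[ℂ] H} (h : ∀ z, X (szego z) = Y (szego z)) : X = Y := by
  ext1 f
  have := mem_of_szego_mem (X - Y) (K := ⊥) isClosed_singleton (fun z => by simp [h z]) f
  simpa [sub_eq_zero] using this

theorem ext_prodFun {n : ℕ} {H : Type*} [NormedAddCommGroup H] [NormedSpace ℂ H]
    {X Y : H2 n →L[ℂ] H} (h : ∀ f, X (prodFun f) = Y (prodFun f)) : X = Y :=
  ext_szego fun z => by rw [szego_eq_prodFun]; exact h _

/-! ### Operators in one of the variables -/

/-- The operator `X` on `H²(𝔻ⁿ)` acts as the operator `X₁` on `H²(𝔻)` in the variable `i`. -/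
def ActsAt {n : ℕ} (i : Fin n) (X : H2 n →L[ℂ] H2 n) (X₁ : H2 1 →L[ℂ] H2 1) : Prop :=
  ∀ f : Fin n → H2 1, X (prodFun f) = prodFun (Function.update f i (X₁ (f i)))

theorem eval_prodFun_update {n : ℕ} (f : Fin n → H2 1) (i : Fin n) (g : H2 1) (z : Fin n → 𝔻) :
    eval (prodFun (Function.update f i g)) z =
      eval g (fun _ => z i) * ∏ j ∈ Finset.univ.erase i, eval (f j) fun _ => z j := by
  rw [eval_prodFun, ← Finset.mul_prod_erase _ _ (Finset.mem_univ i), Function.update_self]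
  congr 1
  refine Finset.prod_congr rfl fun j hj => ?_
  rw [Function.update_of_ne (Finset.ne_of_mem_erase hj)]

theorem actsAt_mulOp {n : ℕ} (i : Fin n) (ψ : 𝔻 → ℂ) (h : IsMultiplier fun z : Fin n → 𝔻 => ψ (z i))
    (h₁ : IsMultiplier fun z : Fin 1 → 𝔻 => ψ (z 0)) : ActsAt i (mulOp _ h) (mulOp _ h₁) := by
  refine fun f => eval_injective fun z => ?_
  rw [eval_mulOp, eval_prodFun_update, eval_mulOp, eval_prodFun,
    ← Finset.mul_prod_erase _ _ (Finset.mem_univ i)]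
  ring

theorem ActsAt.one {n : ℕ} (i : Fin n) : ActsAt i 1 1 := fun f => by simp

theorem ActsAt.sub {n : ℕ} {i : Fin n} {X Y : H2 n →L[ℂ] H2 n} {X₁ Y₁ : H2 1 →L[ℂ] H2 1}
    (hX : ActsAt i X X₁) (hY : ActsAt i Y Y₁) : ActsAt i (X - Y) (X₁ - Y₁) := by
  refine fun f => eval_injective fun z => ?_
  rw [sub_apply, eval_sub, hX, hY]
  simp only [eval_prodFun_update, sub_apply, eval_sub]
  ring

theorem ActsAt.mul {n : ℕ} {i : Fin n} {X Y : H2 n →L[ℂ] H2 n} {X₁ Y₁ : H2 1 →L[ℂ] H2 1}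
    (hX : ActsAt i X X₁) (hY : ActsAt i Y Y₁) : ActsAt i (X * Y) (X₁ * Y₁) := fun f => by
  rw [mul_apply_eq_comp, hY, hX]
  simp

/-- Pairing with a kernel moves the adjoint onto another product function, where the action of `X`
is known. -/
theorem ActsAt.star {n : ℕ} {i : Fin n} {X : H2 n →L[ℂ] H2 n} {X₁ : H2 1 →L[ℂ] H2 1}
    (hX : ActsAt i X X₁) : ActsAt i (star X) (star X₁) := by
  refine fun f => eval_injective fun z => ?_
  rw [eval_eq_inner, eval_eq_inner, ContinuousLinearMap.star_eq_adjoint,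
    ContinuousLinearMap.adjoint_inner_right, szego_eq_prodFun, hX, inner_prodFun, inner_prodFun]
  refine Finset.prod_congr rfl fun j _ => ?_
  rcases eq_or_ne j i with rfl | hj
  · rw [Function.update_self, Function.update_self, ContinuousLinearMap.star_eq_adjoint,
      ContinuousLinearMap.adjoint_inner_right]
  · rw [Function.update_of_ne hj, Function.update_of_ne hj]

theorem ActsAt.commute {n : ℕ} {i j : Fin n} (hij : i ≠ j) {X Y : H2 n →L[ℂ] H2 n}
    {X₁ Y₁ : H2 1 →L[ℂ] H2 1} (hX : ActsAt i X X₁) (hY : ActsAt j Y Y₁) : Commute X Y := by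
  refine ext_prodFun fun f => ?_
  rw [mul_apply_eq_comp, mul_apply_eq_comp, hX, hY, hY, hX,
    Function.update_comm hij, Function.update_of_ne hij, Function.update_of_ne hij.symm]

/-- Without repetitions each variable is acted on at most once, so the result does not depend on the
order of the list. -/
theorem list_prod_prodFun {n : ℕ} {X : Fin n → H2 n →L[ℂ] H2 n} {X₁ : Fin n → H2 1 →L[ℂ] H2 1}
    (h : ∀ i, ActsAt i (X i) (X₁ i)) {l : List (Fin n)} (hl : l.Nodup) (f : Fin n → H2 1) :
    (l.map X).prod (prodFun f) = prodFun fun i => if i ∈ l then X₁ i (f i) else f i := by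
  induction l with
  | nil => simp
  | cons a l ih =>
    obtain ⟨ha, hl⟩ := List.nodup_cons.1 hl
    rw [List.map_cons, List.prod_cons, mul_apply_eq_comp, ih hl, h]
    congr 1
    ext1 i
    rcases eq_or_ne i a with rfl | hi
    · simp [ha]
    · simp [hi]

theorem list_prod_mul_self {n : ℕ} {X : Fin n → H2 n →L[ℂ] H2 n} {X₁ : Fin n → H2 1 →L[ℂ] H2 1}
    (h : ∀ i, ActsAt i (X i) (X₁ i)) (h₁ : ∀ i, X₁ i * X₁ i = X₁ i) {l : List (Fin n)}
    (hl : l.Nodup) : (l.map X).prod * (l.map X).prod = (l.map X).prod := by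
  refine ext_prodFun fun f => ?_
  rw [mul_apply_eq_comp]
  simp only [list_prod_prodFun h hl]
  congr 1
  ext1 i
  split_ifs
  · rw [← mul_apply_eq_comp, h₁]
  · rfl

theorem star_list_prod {n : ℕ} {X : Fin n → H2 n →L[ℂ] H2 n} {X₁ : Fin n → H2 1 →L[ℂ] H2 1}
    (h : ∀ i, ActsAt i (X i) (X₁ i)) (h₁ : ∀ i, star (X₁ i) = X₁ i) {l : List (Fin n)}
    (hl : l.Nodup) : star (l.map X).prod = (l.map X).prod := by
  refine ext_prodFun fun f => eval_injective fun z => ?_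
  rw [eval_eq_inner, eval_eq_inner, ContinuousLinearMap.star_eq_adjoint,
    ContinuousLinearMap.adjoint_inner_right, szego_eq_prodFun, list_prod_prodFun h hl,
    list_prod_prodFun h hl, inner_prodFun, inner_prodFun]
  refine Finset.prod_congr rfl fun i _ => ?_
  split_ifs
  · conv_rhs => rw [← h₁, ContinuousLinearMap.star_eq_adjoint,
      ContinuousLinearMap.adjoint_inner_right]
  · rfl

/-! ### Multiplication by finite Blaschke products -/

theorem star_Mz_mul_Mz {n : ℕ} (i : Fin n) : star (Mz i) * Mz i = 1 := by
  refine (ContinuousLinearMap.norm_map_iff_adjoint_comp_self (Mz i)).1 fun f => ?_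
  obtain ⟨h, hh, hn⟩ := exists_shift i f
  have : Mz i f = h := eval_injective fun z => by rw [Mz, eval_mulOp, hh]
  rw [this, hn]

theorem eval_moebius_Mz {n : ℕ} (i : Fin n) (a : 𝔻) (f : H2 n) (z : Fin n → 𝔻) :
    eval (moebius (Mz i) a f) z = ((z i : ℂ) - a) / (1 - conj (a : ℂ) * z i) * eval f z := by
  obtain ⟨g, -, hg, -, hr⟩ := exists_resolvent (norm_Mz_le i) a.norm_lt_one ⊤ isClosed_univ trivial
  have h1 : eval f z = (1 - conj (a : ℂ) * z i) * eval (g f) z := by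
    have h := congrArg (fun X : H2 n →L[ℂ] H2 n => eval (X f) z) hr
    simp only [mul_apply_eq_comp, sub_apply,
      one_apply_eq_self, smul_apply, eval_sub, eval_smul, Mz,
      eval_mulOp] at h
    rw [← h]; ring
  have hne : (1 : ℂ) - conj (a : ℂ) * z i ≠ 0 := by
    intro h0
    have : ‖conj (a : ℂ) * z i‖ < 1 := by
      rw [norm_mul, RCLike.norm_conj]
      exact mul_lt_one_of_nonneg_of_lt_one_left (norm_nonneg _) a.norm_lt_one (z i).norm_lt_one.le
    rw [← sub_eq_zero.1 h0] at this
    simp at this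
  rw [moebius, hg, mul_apply_eq_comp, h1, ← mul_assoc, div_mul_cancel₀ _ hne]
  simp only [sub_apply, one_apply_eq_self,
    smul_apply, eval_sub, eval_smul, Mz, eval_mulOp]
  ring

/-- The operator of multiplication by `φ(z_i)`, for a finite Blaschke product `φ`. -/
def blaschkeOp {φ : 𝔻 → ℂ} (hφ : IsFiniteBlaschke φ) {n : ℕ} (i : Fin n) : H2 n →L[ℂ] H2 n :=
  mulOp (fun z => φ (z i)) (hφ.isMultiplier i)

/-- Links the analytic and algebraic notions of Blaschke product: both operators multiply values by
the same function, and values determine an element of `H2`. -/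
theorem isBlaschkeOf_blaschkeOp {φ : 𝔻 → ℂ} (hφ : IsFiniteBlaschke φ) {n : ℕ} (i : Fin n) :
    IsBlaschkeOf (Mz i) (blaschkeOp hφ i) := by
  have key : ∀ (c : ℂ) (N : ℕ) (a : Fin N → 𝔻), ‖c‖ = 1 → ∃ W : H2 n →L[ℂ] H2 n,
      IsBlaschkeOf (Mz i) W ∧ ∀ f z, eval (W f) z =
        (c * ∏ j, ((z i : ℂ) - a j) / (1 - conj (a j : ℂ) * z i)) * eval f z := by
    intro c N a hc
    induction N with
    | zero => exact ⟨c • 1, .const c hc, fun f z => by simp [eval_smul]⟩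
    | succ N ih =>
      obtain ⟨W, hW, hW'⟩ := ih (Fin.tail a)
      refine ⟨_, .mul (a 0) (a 0).norm_lt_one W hW, fun f z => ?_⟩
      rw [mul_apply_eq_comp, eval_moebius_Mz, hW', Fin.prod_univ_succ]
      simp only [Fin.tail]
      ring
  obtain ⟨c, N, a, hc, h⟩ := id hφ
  obtain ⟨W, hW, hW'⟩ := key c N a hc
  have : blaschkeOp hφ i = W := by
    ext1 f
    exact eval_injective fun z => by rw [blaschkeOp, eval_mulOp, hW', h]
  rwa [this]

/-- The projection onto the functions which are orthogonal to the multiples of `φ(z_i)`. -/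
def defect {φ : 𝔻 → ℂ} (hφ : IsFiniteBlaschke φ) {n : ℕ} (i : Fin n) : H2 n →L[ℂ] H2 n :=
  1 - blaschkeOp hφ i * star (blaschkeOp hφ i)

theorem star_blaschkeOp_mul_self {φ : 𝔻 → ℂ} (hφ : IsFiniteBlaschke φ) {n : ℕ} (i : Fin n) :
    star (blaschkeOp hφ i) * blaschkeOp hφ i = 1 :=
  (isBlaschkeOf_blaschkeOp hφ i).star_mul_self (norm_Mz_le i) (star_Mz_mul_Mz i)

theorem star_defect {φ : 𝔻 → ℂ} (hφ : IsFiniteBlaschke φ) {n : ℕ} (i : Fin n) :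
    star (defect hφ i) = defect hφ i := by
  simp [defect]

theorem star_blaschkeOp_mul_defect {φ : 𝔻 → ℂ} (hφ : IsFiniteBlaschke φ) {n : ℕ} (i : Fin n) :
    star (blaschkeOp hφ i) * defect hφ i = 0 := by
  rw [defect, mul_sub, ← mul_assoc, star_blaschkeOp_mul_self]
  simp

theorem defect_mul_self {φ : 𝔻 → ℂ} (hφ : IsFiniteBlaschke φ) {n : ℕ} (i : Fin n) :
    defect hφ i * defect hφ i = defect hφ i := by
  nth_rewrite 1 [defect]
  rw [sub_mul, mul_assoc, star_blaschkeOp_mul_defect]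
  simp

theorem actsAt_blaschkeOp {φ : 𝔻 → ℂ} (hφ : IsFiniteBlaschke φ) {n : ℕ} (i : Fin n) :
    ActsAt i (blaschkeOp hφ i) (blaschkeOp hφ 0) :=
  actsAt_mulOp i φ _ _

theorem actsAt_Mz {n : ℕ} (i : Fin n) : ActsAt i (Mz i) (Mz 0) :=
  actsAt_mulOp i (fun w => (w : ℂ)) _ _

theorem actsAt_defect {φ : 𝔻 → ℂ} (hφ : IsFiniteBlaschke φ) {n : ℕ} (i : Fin n) :
    ActsAt i (defect hφ i) (defect hφ 0) :=
  (ActsAt.one i).sub ((actsAt_blaschkeOp hφ i).mul (actsAt_blaschkeOp hφ i).star)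

theorem defect_apply_of_mem_Qone {φ : 𝔻 → ℂ} (hφ : IsFiniteBlaschke φ) {f : H2 1}
    (hf : f ∈ Qone φ) : defect hφ 0 f = f := by
  have h : star (blaschkeOp hφ (0 : Fin 1)) f = 0 := by
    refine ext_inner_left ℂ fun g => ?_
    rw [ContinuousLinearMap.star_eq_adjoint, ContinuousLinearMap.adjoint_inner_right, inner_zero_right]
    exact hf _ ⟨g, fun z => eval_mulOp _ _ _ _⟩
  rw [defect, sub_apply, mul_apply_eq_comp, h]
  simp

/-- Together with `defect_apply_of_mem_Qone` this identifies the one-variable defect as the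
projection onto `Q_φ`. -/
theorem defect_apply_mem_Qone {φ : 𝔻 → ℂ} (hφ : IsFiniteBlaschke φ) (f : H2 1) :
    defect hφ 0 f ∈ Qone φ := by
  rintro _ ⟨g, hg⟩
  have : blaschkeOp hφ (0 : Fin 1) g = _ :=
    eval_injective fun z => (eval_mulOp _ _ _ _).trans (hg z).symm
  rw [← this, ← ContinuousLinearMap.adjoint_inner_right, ← ContinuousLinearMap.star_eq_adjoint,
    ← mul_apply_eq_comp, star_blaschkeOp_mul_defect]
  simp

/-! ### The projections onto the subspaces -/

theorem starProjection_eq_of_star_eq {H : Type*} [NormedAddCommGroup H] [InnerProductSpace ℂ H]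
    [CompleteSpace H] (K : Submodule ℂ H) [K.HasOrthogonalProjection] {p : H →L[ℂ] H}
    (hs : star p = p) (h : ∀ f, p f ∈ K) (h' : ∀ f ∈ K, p f = f) : K.starProjection = p := by
  ext1 f
  refine Submodule.eq_starProjection_of_mem_orthogonal (h f) ?_
  intro g hg
  rw [inner_sub_right, ← ContinuousLinearMap.adjoint_inner_left, ← ContinuousLinearMap.star_eq_adjoint,
    hs, h' g hg, sub_self]

/-- Conjugation by a unitary is a star isomorphism and a homeomorphism, so it passes through both
the algebraic span and the closure. -/
theorem image_cstarGen {ι H K : Type*} [NormedAddCommGroup H] [InnerProductSpace ℂ H]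
    [CompleteSpace H] [NormedAddCommGroup K] [InnerProductSpace ℂ K] [CompleteSpace K]
    (e : H ≃ₗᵢ[ℂ] K) (A : ι → H →L[ℂ] H) :
    e.conjStarAlgEquiv '' (cstarGen A : Set (H →L[ℂ] H)) =
      (cstarGen fun i => e.conjStarAlgEquiv (A i) : Set (K →L[ℂ] K)) := by
  have h := StarSubalgebra.topologicalClosure_map (StarAlgebra.adjoin ℂ (Set.range A))
    e.conjStarAlgEquiv.toStarAlgHom
    e.toContinuousLinearEquiv.conjContinuousAlgEquiv.toHomeomorph.isClosedMap
    e.toContinuousLinearEquiv.conjContinuousAlgEquiv.continuous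
  rw [StarAlgHom.map_adjoin, ← Set.range_comp] at h
  exact (congrArg (fun B : StarSubalgebra ℂ (K →L[ℂ] K) => (B : Set (K →L[ℂ] K))) h).symm

/-- The product of the defect projections of `φ_i(z_i)`, for `i` in a list. -/
def defectProd {n : ℕ} {φ : Fin n → 𝔻 → ℂ} (hφ : ∀ i, IsFiniteBlaschke (φ i))
    (l : List (Fin n)) : H2 n →L[ℂ] H2 n :=
  (l.map fun i => defect (hφ i) i).prod

section

variable {n : ℕ} {φ : Fin n → 𝔻 → ℂ} (hφ : ∀ i, IsFiniteBlaschke (φ i))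

theorem star_defectProd {l : List (Fin n)} (hl : l.Nodup) :
    star (defectProd hφ l) = defectProd hφ l :=
  star_list_prod (fun i => actsAt_defect (hφ i) i) (fun i => star_defect (hφ i) 0) hl

theorem defectProd_mul_self {l : List (Fin n)} (hl : l.Nodup) :
    defectProd hφ l * defectProd hφ l = defectProd hφ l :=
  list_prod_mul_self (fun i => actsAt_defect (hφ i) i) (fun i => defect_mul_self (hφ i) 0) hl

theorem defectProd_prodFun {l : List (Fin n)} (hl : l.Nodup) (f : Fin n → H2 1) :
    defectProd hφ l (prodFun f) =
      prodFun fun i => if i ∈ l then defect (hφ i) 0 (f i) else f i :=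
  list_prod_prodFun (fun i => actsAt_defect (hφ i) i) hl f

theorem defectProd_finRange_mem (f : H2 n) :
    defectProd hφ (List.finRange n) f ∈ tensorPi fun i => Qone (φ i) := by
  refine mem_of_szego_mem _ (Submodule.isClosed_topologicalClosure _) (fun z => ?_) f
  refine Submodule.le_topologicalClosure _ (Submodule.subset_span ?_)
  refine ⟨fun i => defect (hφ i) 0 (szego fun _ => z i),
    fun i => defect_apply_mem_Qone (hφ i) _, fun w => ?_⟩
  rw [szego_eq_prodFun, defectProd_prodFun hφ (List.nodup_finRange n)]
  simp [eval_prodFun]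

theorem defectProd_finRange_apply {f : H2 n} (hf : f ∈ tensorPi fun i => Qone (φ i)) :
    defectProd hφ (List.finRange n) f = f := by
  have hle : (tensorPi fun i => Qone (φ i)) ≤
      (LinearMap.ker (defectProd hφ (List.finRange n) - 1 : H2 n →L[ℂ] H2 n).toLinearMap) := by
    refine Submodule.topologicalClosure_minimal _ (Submodule.span_le.2 ?_)
      (ContinuousLinearMap.isClosed_ker (defectProd hφ (List.finRange n) - 1 : H2 n →L[ℂ] H2 n))
    rintro F ⟨g, hg, hF⟩
    have : F = prodFun g := eval_injective fun z => by rw [hF, eval_prodFun]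
    rw [this]
    change defectProd hφ (List.finRange n) (prodFun g) - prodFun g = 0
    rw [defectProd_prodFun hφ (List.nodup_finRange n), sub_eq_zero]
    congr 1
    ext1 i
    rw [if_pos (List.mem_finRange i), defect_apply_of_mem_Qone (hφ i) (hg i)]
  exact sub_eq_zero.1 (hle hf)

theorem starProjection_SPhi :
    (SPhi φ).starProjection = 1 - defectProd hφ (List.finRange n) := by
  refine starProjection_eq_of_star_eq _ ?_ (fun f g hg => ?_) fun f hf => ?_
  · rw [star_sub, star_one, star_defectProd hφ (List.nodup_finRange n)]
  · rw [← defectProd_finRange_apply hφ hg]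
    nth_rewrite 1 [← star_defectProd hφ (List.nodup_finRange n)]
    rw [ContinuousLinearMap.star_eq_adjoint, ContinuousLinearMap.adjoint_inner_left,
      ← mul_apply_eq_comp, mul_sub, defectProd_mul_self hφ (List.nodup_finRange n)]
    simp
  · have h : defectProd hφ (List.finRange n) f = 0 := by
      refine ext_inner_left ℂ fun g => ?_
      rw [← ContinuousLinearMap.adjoint_inner_left, ← ContinuousLinearMap.star_eq_adjoint,
        star_defectProd hφ (List.nodup_finRange n), inner_zero_right]
      exact hf _ (defectProd_finRange_mem hφ g)
    simp [h]

end

theorem starProjection_tensorLast {m : ℕ} {A : Submodule ℂ (H2 m)} {p : H2 m →L[ℂ] H2 m}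
    (hp : star p = p) (hA : ∀ f, p f ∈ A) (hA' : ∀ f ∈ A, p f = f)
    {q : H2 (m + 1) →L[ℂ] H2 (m + 1)} (hq : star q = q)
    (hpq : ∀ z, q (szego z) = tens (p (szego (Fin.init z))) (szego fun _ => z (Fin.last m))) :
    (tensorLast A ⊤).starProjection = q := by
  refine starProjection_eq_of_star_eq _ hq (fun f => ?_) fun f hf => ?_
  · refine mem_of_szego_mem _ (Submodule.isClosed_topologicalClosure _) (fun z => ?_) f
    refine Submodule.le_topologicalClosure _ (Submodule.subset_span ?_)
    exact ⟨_, hA _, _, Submodule.mem_top, fun w => by rw [hpq, eval_tens]⟩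
  · have hle : tensorLast A ⊤ ≤ LinearMap.ker (q - 1 : H2 (m + 1) →L[ℂ] H2 (m + 1)).toLinearMap := by
      refine Submodule.topologicalClosure_minimal _ (Submodule.span_le.2 ?_)
        (ContinuousLinearMap.isClosed_ker (q - 1 : H2 (m + 1) →L[ℂ] H2 (m + 1)))
      rintro F ⟨g, hg, h, -, hF⟩
      have : F = tens g h := eval_injective fun z => by rw [hF, eval_tens]
      rw [this]
      change q (tens g h) - tens g h = 0
      -- Only `q` on kernels is known, so `q` is moved onto the kernel by self-adjointness; `p` is
      -- then moved back onto `g`, which it fixes.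
      refine sub_eq_zero.2 (eval_injective fun z => ?_)
      rw [eval_eq_inner, ← hq, ContinuousLinearMap.star_eq_adjoint,
        ContinuousLinearMap.adjoint_inner_right, hpq, inner_tens, ← hp,
        ContinuousLinearMap.star_eq_adjoint, ContinuousLinearMap.adjoint_inner_left, hA' g hg,
        eval_tens, eval_eq_inner, eval_eq_inner]
    exact sub_eq_zero.1 (hle hf)

/-! ### The unitary `U` and conjugation of the Toeplitz algebras -/

section

variable {m : ℕ} {φ : Fin (m + 1) → 𝔻 → ℂ} (hφ : ∀ i, IsFiniteBlaschke (φ i))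

/-- The product of the defect projections in all variables but the last. -/
def defectInit : H2 (m + 1) →L[ℂ] H2 (m + 1) :=
  defectProd hφ ((List.finRange m).map Fin.castSucc)

theorem nodup_castSucc_finRange : ((List.finRange m).map Fin.castSucc).Nodup :=
  (List.nodup_finRange m).map (Fin.castSucc_injective m)

theorem star_defectInit : star (defectInit hφ) = defectInit hφ :=
  star_defectProd hφ nodup_castSucc_finRange

theorem defectInit_mul_self : defectInit hφ * defectInit hφ = defectInit hφ :=
  defectProd_mul_self hφ nodup_castSucc_finRange

theorem defectInit_szego (z : Fin (m + 1) → 𝔻) :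
    defectInit hφ (szego z) =
      tens (defectProd (fun i : Fin m => hφ i.castSucc) (List.finRange m) (szego (Fin.init z)))
        (szego fun _ => z (Fin.last m)) := by
  rw [defectInit, szego_eq_prodFun, defectProd_prodFun hφ nodup_castSucc_finRange, prodFun,
    szego_eq_prodFun (Fin.init z), defectProd_prodFun _ (List.nodup_finRange m)]
  congr 2
  · ext1 i
    simp [Fin.init]
  · simp

theorem starProjection_L3 : (L3 φ).starProjection = defectInit hφ :=
  starProjection_tensorLast (star_defectProd _ (List.nodup_finRange m))
    (defectProd_finRange_mem fun i : Fin m => hφ i.castSucc)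
    (fun _ hf => defectProd_finRange_apply (fun i : Fin m => hφ i.castSucc) hf)
    (star_defectInit hφ) (defectInit_szego hφ)

theorem starProjection_L1 : (L1 φ).starProjection = 1 - defectInit hφ := by
  have hS := starProjection_SPhi fun i : Fin m => hφ i.castSucc
  refine starProjection_tensorLast (A := SPhi fun i : Fin m => φ i.castSucc)
    (p := 1 - defectProd (fun i : Fin m => hφ i.castSucc) (List.finRange m)) ?_ (fun f => ?_)
    (fun f hf => ?_) ?_ fun z => ?_
  · rw [star_sub, star_one, star_defectProd _ (List.nodup_finRange m)]
  · rw [← hS]; exact Submodule.starProjection_apply_mem _ f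
  · rw [← hS]; exact Submodule.starProjection_eq_self_iff.2 hf
  · rw [star_sub, star_one, star_defectInit]
  · refine eval_injective fun w => ?_
    rw [sub_apply, one_apply_eq_self, defectInit_szego]
    nth_rewrite 1 [szego_eq_tens]
    simp only [eval_sub, eval_tens, sub_apply, one_apply_eq_self]
    ring

theorem defectProd_finRange_succ : defectProd hφ (List.finRange (m + 1)) =
    defectInit hφ * defect (hφ (Fin.last m)) (Fin.last m) := by
  simp [defectInit, defectProd, List.finRange_succ_last]

theorem UPhi_eq : UPhi φ hφ = 1 - defectInit hφ +
    blaschkeOp (hφ (Fin.last m)) (Fin.last m) * defectInit hφ := by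
  rw [UPhi, starProjection_L1 hφ, starProjection_L3 hφ]
  rfl

/-- Each factor is `1 - WW*` with `W` a finite Blaschke product of one of the first `m` coordinate
operators. -/
theorem defectInit_mem :
    defectInit hφ ∈ closedAdjoin (Set.range fun i : Fin m => Mz (n := m + 1) i.castSucc) := by
  refine list_prod_mem fun x hx => ?_
  obtain ⟨_, hi, rfl⟩ := List.mem_map.1 hx
  obtain ⟨i, -, rfl⟩ := List.mem_map.1 hi
  have h := (isBlaschkeOf_blaschkeOp (hφ i.castSucc) (n := m + 1) i.castSucc).mem (norm_Mz_le _)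
    (star_Mz_mul_Mz _) _ (isClosed_closedAdjoin _)
    (subset_closedAdjoin (Set.range fun i : Fin m => Mz (n := m + 1) i.castSucc) ⟨i, rfl⟩)
  exact sub_mem (one_mem _) (mul_mem h (star_mem h))

/-- Operators in different variables commute, so `isometry_of_corner` applies; the resulting defect
is the product of the defects in all variables, which projects onto `S_Φ^⊥`. -/
theorem isometry_UPhi : star (UPhi φ hφ) * UPhi φ hφ = 1 ∧
    UPhi φ hφ * star (UPhi φ hφ) = (SPhi φ).starProjection := by
  have hc : Commute (defectInit hφ) (blaschkeOp (hφ (Fin.last m)) (Fin.last m)) ∧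
      Commute (defectInit hφ) (star (blaschkeOp (hφ (Fin.last m)) (Fin.last m))) := by
    refine commute_of_mem_closedAdjoin ?_ ?_ (defectInit_mem hφ)
    · rintro _ ⟨i, rfl⟩
      exact (actsAt_Mz _).commute (Fin.castSucc_lt_last i).ne (actsAt_blaschkeOp _ _)
    · rintro _ ⟨i, rfl⟩
      exact (actsAt_Mz _).commute (Fin.castSucc_lt_last i).ne (actsAt_blaschkeOp _ _).star
  obtain ⟨h1, h2⟩ := isometry_of_corner (star_defectInit hφ) (defectInit_mul_self hφ) hc.1 hc.2
    (star_blaschkeOp_mul_self _ _) (UPhi_eq hφ)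
  refine ⟨h1, ?_⟩
  rw [starProjection_SPhi hφ, defectProd_finRange_succ, defect, ← h2]
  abel

theorem closedAdjoin_conj_UPhi :
    closedAdjoin (Set.range fun i => star (UPhi φ hφ) * Mz i * UPhi φ hφ) = toeplitzFull (m + 1) := by
  have hr : Set.range (Mz (n := m + 1)) =
      insert (Mz (Fin.last m)) (Set.range fun i : Fin m => Mz (n := m + 1) i.castSucc) := by
    ext x
    simp [Fin.exists_fin_succ', or_comm, eq_comm]
  have h := closedAdjoin_conj_eq (norm_Mz_le (Fin.last m)) (star_Mz_mul_Mz (Fin.last m))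
    (s := Set.range fun i : Fin m => Mz (n := m + 1) i.castSucc) ?_ ?_ (defectInit_mem hφ)
    (star_defectInit hφ) (defectInit_mul_self hφ) (isBlaschkeOf_blaschkeOp _ _) (UPhi_eq hφ)
  · rw [← hr, ← Set.range_comp] at h
    exact h
  · rintro _ ⟨i, rfl⟩
    exact (actsAt_Mz _).commute (Fin.castSucc_lt_last i).ne (actsAt_Mz _)
  · rintro _ ⟨i, rfl⟩
    exact (actsAt_Mz _).commute (Fin.castSucc_lt_last i).ne (actsAt_Mz _).star

/-- `U`, as a unitary operator onto `S_Φ`. -/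
def unitaryPhi : H2 (m + 1) ≃ₗᵢ[ℂ] SPhi φ :=
  LinearIsometryEquiv.ofSurjective
    { toLinearMap := (UPhi φ hφ : H2 (m + 1) →ₗ[ℂ] H2 (m + 1)).codRestrict (SPhi φ) fun f => by
        have h : (UPhi φ hφ * star (UPhi φ hφ)) * UPhi φ hφ = UPhi φ hφ := by
          rw [mul_assoc, (isometry_UPhi hφ).1, mul_one]
        change UPhi φ hφ f ∈ _
        rw [← h, (isometry_UPhi hφ).2]
        exact Submodule.starProjection_apply_mem _ _
      norm_map' := (ContinuousLinearMap.norm_map_iff_adjoint_comp_self _).2 (isometry_UPhi hφ).1 }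
    fun x => ⟨star (UPhi φ hφ) x, Subtype.ext <| by
      change (UPhi φ hφ * star (UPhi φ hφ)) x = x
      rw [(isometry_UPhi hφ).2]
      exact Submodule.starProjection_eq_self_iff.2 x.2⟩

theorem coe_unitaryPhi (f : H2 (m + 1)) : (unitaryPhi hφ f : H2 (m + 1)) = UPhi φ hφ f := rfl

theorem unitaryPhi_symm_apply (x : SPhi φ) :
    (unitaryPhi hφ).symm x = star (UPhi φ hφ) x := by
  rw [LinearIsometryEquiv.symm_apply_eq]
  refine Subtype.ext ?_
  change (x : H2 (m + 1)) = (UPhi φ hφ * star (UPhi φ hφ)) x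
  rw [(isometry_UPhi hφ).2]
  exact (Submodule.starProjection_eq_self_iff.2 x.2).symm

/-- The projection in `R_{z_i}` disappears: `P_S = UU*` and `U*U = 1` give `U*P_S = U*`. -/
theorem conj_Rz (i : Fin (m + 1)) :
    (unitaryPhi hφ).symm.conjStarAlgEquiv (Rz (SPhi φ) i) =
      star (UPhi φ hφ) * Mz i * UPhi φ hφ := by
  ext1 f
  change (unitaryPhi hφ).symm (Rz (SPhi φ) i (unitaryPhi hφ f)) = _
  rw [unitaryPhi_symm_apply]
  change star (UPhi φ hφ) ((SPhi φ).starProjection (Mz i (UPhi φ hφ f))) = _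
  rw [← (isometry_UPhi hφ).2]
  have : star (UPhi φ hφ) * (UPhi φ hφ * star (UPhi φ hφ)) = star (UPhi φ hφ) := by
    rw [← mul_assoc, (isometry_UPhi hφ).1, one_mul]
  exact congrArg (fun X : H2 (m + 1) →L[ℂ] H2 (m + 1) => X (Mz i (UPhi φ hφ f))) this

theorem image_toeplitz_eq :
    (unitaryPhi hφ).symm.conjStarAlgEquiv '' (toeplitz (SPhi φ) : Set (SPhi φ →L[ℂ] SPhi φ)) =
      (toeplitzFull (m + 1) : Set (H2 (m + 1) →L[ℂ] H2 (m + 1))) := by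
  rw [toeplitz, image_cstarGen, ← closedAdjoin_conj_UPhi hφ, cstarGen, closedAdjoin]
  simp only [conj_Rz]

end

end PolydiscHardy

end

theorem theorem5p4 (m : ℕ) (hm : 1 ≤ m) (φ : Fin (m + 1) → Complex.UnitDisc → ℂ)
    (hφ : ∀ i, PolydiscHardy.IsFiniteBlaschke (φ i)) :
    ∃ U : PolydiscHardy.H2 (m + 1) ≃ₗᵢ[ℂ] PolydiscHardy.SPhi φ,
      (∀ f, (U f : PolydiscHardy.H2 (m + 1)) = PolydiscHardy.UPhi φ hφ f) ∧
      (fun T : PolydiscHardy.SPhi φ →L[ℂ] PolydiscHardy.SPhi φ =>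
          (U.symm : PolydiscHardy.SPhi φ →L[ℂ] PolydiscHardy.H2 (m + 1)) ∘L T ∘L
            (U : PolydiscHardy.H2 (m + 1) →L[ℂ] PolydiscHardy.SPhi φ)) ''
          (PolydiscHardy.toeplitz (PolydiscHardy.SPhi φ) : Set _) =
        (PolydiscHardy.toeplitzFull (m + 1) : Set _) :=
  ⟨PolydiscHardy.unitaryPhi hφ, PolydiscHardy.coe_unitaryPhi hφ,
    PolydiscHardy.image_toeplitz_eq hφ⟩
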